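/- Let $\mathbb{S}^1=\mathbb{R}/\mathbb{Z}$ and let $d\ge 2$. Let $\mathcal{D}$ be a regularity class from Hölder to $C^\infty$, that is, any set of orientation-preserving homeomorphisms of $\mathbb{S}^1$ which contains all orientation-preserving $C^\infty$ diffeomorphisms and all of whose elements are Hölder continuous with some positive exponent. (Examples: all Hölder homeomorphisms; the $\beta$-Hölder homeomorphisms, $0<\beta\le 1$; the $C^{k}$ diffeomorphisms, $1\le k\le\infty$; the $C^{k+\beta}$ diffeomorphisms, $k\ge 1$, $0<\beta<1$; all orientation-preserving.) Let $\mathcal{A}_d$ be the space of free actions $\rho$ of $\mathbb{Z}^d$ on $\mathbb{S}^1$ by orientation-preserving $C^\infty$ diffeomorphisms, where free means that $\rho(n)x\neq x$ for all $x\in\mathbb{S}^1$ and all $n\in\mathbb{Z}^d\setminus\{0\}$. Give $\mathcal{A}_d$ the topology of $\mathrm{Diff}^\infty_+(\mathbb{S}^1)^d$, through the images of the $d$ standard generators; here $\mathrm{Diff}^\infty_+(\mathbb{S}^1)$ carries the $C^\infty$ topology (uniform convergence of the diffeomorphisms, of their inverses, and of all derivatives of both). Call $\rho,\sigma\in\mathcal{A}_d$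 $\mathcal{D}$-conjugate if there is $h\in\mathcal{D}$ with $\rho(n)=h\circ\sigma(n)\circ h^{-1}$ for all $n\in\mathbb{Z}^d$. Then there is no complete numerical Borel invariant for $\mathcal{D}$-conjugacy on $\mathcal{A}_d$: there is no Borel function $\varphi:\mathcal{A}_d\to\mathbb{R}$ such that, for all $\rho,\sigma\in\mathcal{A}_d$, $\rho$ and $\sigma$ are $\mathcal{D}$-conjugate if and only if $\varphi(\rho)=\varphi(\sigma)$. -/

import Mathlib

open scoped NNReal ContDiff UniformConvergence

namespace CircleActions

/-- The circle `ℝ / ℤ`, with its quotient metric. -/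
abbrev S1 : Type := UnitAddCircle

/-- `F` is a lift of the circle map `f`: an increasing continuous function on the line with
`π ∘ F = f ∘ π`. -/
def IsLift (F : ℝ → ℝ) (f : S1 → S1) : Prop :=
  StrictMono F ∧ Continuous F ∧ ∀ x : ℝ, ((F x : ℝ) : S1) = f (x : S1)

/-- A homeomorphism of the circle is orientation-preserving if it has an (increasing) lift. -/
def OrientationPreserving (f : S1 ≃ₜ S1) : Prop := ∃ F : ℝ → ℝ, IsLift F f

/-- Orientation-preserving diffeomorphisms of class `C^k` of the circle (`k = ⊤` means smooth):
the map and its inverse have lifts of class `C^k`. -/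
def diffeos (k : ℕ∞) : Set (S1 ≃ₜ S1) :=
  {f | (∃ F : ℝ → ℝ, IsLift F f ∧ ContDiff ℝ k F) ∧
       (∃ F : ℝ → ℝ, IsLift F f.symm ∧ ContDiff ℝ k F)}

/-- Orientation-preserving homeomorphisms of the circle that are Hölder continuous for some
positive exponent. -/
def holderHomeos : Set (S1 ≃ₜ S1) :=
  {h | OrientationPreserving h ∧ ∃ C r : ℝ≥0, 0 < r ∧ HolderWith C r h}

/-- A regularity class of circle homeomorphisms between Hölder and `C^∞`: it consists of
orientation-preserving Hölder homeomorphisms, and it contains all orientation-preserving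
`C^∞` diffeomorphisms. -/
def IsRegularityClass (D : Set (S1 ≃ₜ S1)) : Prop :=
  diffeos ⊤ ⊆ D ∧ D ⊆ holderHomeos

/-- `Diff^∞_+(ℝ / ℤ)` as a type. -/
def SmoothDiffeo : Type := {f : S1 ≃ₜ S1 // f ∈ diffeos ⊤}

/-- A choice of a lift. Two lifts differ by an integer constant, so that the derivatives of the
lift do not depend on the choice. -/
noncomputable def lift (f : S1 ≃ₜ S1) : ℝ → ℝ := Classical.epsilon fun F => IsLift F f

/-- A circle diffeomorphism together with all its derivatives `D^1 f, D^2 f, …`, in spaces of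
functions with the topology of uniform convergence. -/
noncomputable def jets (f : S1 ≃ₜ S1) : (S1 →ᵤ S1) × (ℕ → (ℝ →ᵤ ℝ)) :=
  (UniformFun.ofFun f, fun i => UniformFun.ofFun (iteratedDeriv (i + 1) (lift f)))

/-- The `C^∞` topology: uniform convergence of the maps, of their inverses, and of the derivatives
of all orders of both. -/
noncomputable instance : TopologicalSpace SmoothDiffeo :=
  TopologicalSpace.induced (fun f => (jets f.1, jets f.1.symm)) inferInstance

/-- Free actions of `ℤ^d` by orientation-preserving `C^∞` diffeomorphisms of the circle: group
homomorphisms `n ↦ ρ n` from `ℤ^d` such that every `ρ n` is such a diffeomorphism and only the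
neutral element has a fixed point. -/
def FreeAction (d : ℕ) : Type :=
  {ρ : Multiplicative (Fin d → ℤ) →* (S1 ≃ₜ S1) //
    (∀ n, ρ n ∈ diffeos ⊤) ∧ ∀ n x, ρ n x = x → n = 1}

/-- The `d` generators of an action of `ℤ^d`. -/
def FreeAction.generators {d : ℕ} (ρ : FreeAction d) : Fin d → SmoothDiffeo :=
  fun i => ⟨ρ.1 (Multiplicative.ofAdd (Pi.single i 1)), ρ.2.1 _⟩

/-- The `C^∞` topology on the space of actions: that of `(Diff^∞_+)^d`, through the generators. -/
noncomputable instance (d : ℕ) : TopologicalSpace (FreeAction d) :=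
  TopologicalSpace.induced FreeAction.generators inferInstance

/-- Two actions are `D`-conjugate if some `h` in `D` satisfies `ρ n = h ∘ σ n ∘ h⁻¹` for all
`n`. -/
def Conjugate {d : ℕ} (D : Set (S1 ≃ₜ S1)) (ρ σ : FreeAction d) : Prop :=
  ∃ h ∈ D, ∀ n x, ρ.1 n x = h (σ.1 n (h.symm x))

/-- A complete numerical Borel invariant of a relation `E` on a topological space: a Borel function
to the reals that takes equal values exactly at related points. -/
def IsCompleteNumericalBorelInvariant {X : Type*} [TopologicalSpace X] (E : X → X → Prop)
    (φ : X → ℝ) : Prop :=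
  @Measurable X ℝ (borel X) (borel ℝ) φ ∧ ∀ x y, E x y ↔ φ x = φ y

/-! The usual degrees of regularity are regularity classes. -/

/-- Orientation-preserving homeomorphisms of the circle that are Hölder continuous with the
exponent `β`. -/
def holderHomeosWith (β : ℝ≥0) : Set (S1 ≃ₜ S1) :=
  {h | OrientationPreserving h ∧ ∃ C : ℝ≥0, HolderWith C β h}

/-- Orientation-preserving `C^k` diffeomorphisms of the circle whose `k`-th derivative is
Hölder continuous with the exponent `β` (for `k ≥ 1`). -/
def holderDiffeos (k : ℕ) (β : ℝ≥0) : Set (S1 ≃ₜ S1) :=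
  {h | h ∈ diffeos k ∧
    ∃ F : ℝ → ℝ, IsLift F h ∧ ∃ C : ℝ≥0, HolderWith C β (iteratedDeriv k F)}

theorem IsLift.add_one {F : ℝ → ℝ} {f : S1 ≃ₜ S1} (h : IsLift F f) (x : ℝ) :
    F (x + 1) = F x + 1 := by
  obtain ⟨hm, hc, hl⟩ := h
  have key : ∀ a b : ℝ, (a : S1) = (b : S1) ↔ ∃ n : ℤ, (n : ℝ) = a - b := by
    intro a b
    rw [← sub_eq_zero, ← AddCircle.coe_sub, AddCircle.coe_eq_zero_iff]
    simp
  have h1 : ((F (x + 1) : ℝ) : S1) = ((F x : ℝ) : S1) := by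
    rw [hl, hl, AddCircle.coe_add_period 1 x]
  obtain ⟨m, hm'⟩ := (key _ _).1 h1
  have hlt : F x < F (x + 1) := hm (by linarith)
  have hm0 : 0 < m := by
    have : (0 : ℝ) < m := by linarith
    exact_mod_cast this
  rcases (show m = 1 ∨ 2 ≤ m by omega) with rfl | h2
  · push_cast at hm'
    linarith
  · exfalso
    have h2' : (2 : ℝ) ≤ m := by exact_mod_cast h2
    obtain ⟨y, hy, hFy⟩ := intermediate_value_Icc (by linarith : x ≤ x + 1) hc.continuousOn
      (show F x + 1 ∈ Set.Icc (F x) (F (x + 1)) from ⟨by linarith, by linarith⟩)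
    have h3 : ((F y : ℝ) : S1) = ((F x : ℝ) : S1) := (key _ _).2 ⟨1, by rw [hFy]; push_cast; ring⟩
    rw [hl, hl] at h3
    obtain ⟨n, hn⟩ := (key _ _).1 (f.injective h3)
    have hxy : x < y := hm.lt_iff_lt.1 (by linarith)
    have hyx : y < x + 1 := hm.lt_iff_lt.1 (by linarith)
    have n0 : 0 < n := by
      have : (0 : ℝ) < n := by linarith
      exact_mod_cast this
    have n1 : n < 1 := by
      have : (n : ℝ) < 1 := by linarith
      exact_mod_cast this
    omega

theorem exists_lipschitzWith {g : ℝ → ℝ} (hp : Function.Periodic (deriv g) 1)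
    (hg : ContDiff ℝ 1 g) : ∃ K : ℝ≥0, LipschitzWith K g := by
  obtain ⟨R, hR⟩ := (hp.isBounded_of_continuous one_ne_zero
    (hg.continuous_deriv le_rfl)).exists_norm_le
  refine ⟨R.toNNReal, lipschitzWith_of_nnnorm_deriv_le (hg.differentiable one_ne_zero) fun x => ?_⟩
  rw [← NNReal.coe_le_coe, coe_nnnorm]
  exact (hR _ ⟨x, rfl⟩).trans (Real.le_coe_toNNReal R)

theorem IsLift.periodic {F : ℝ → ℝ} {f : S1 ≃ₜ S1} (h : IsLift F f) (k : ℕ) :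
    Function.Periodic (iteratedDeriv (k + 1) F) 1 := by
  induction k with
  | zero =>
    intro x
    rw [zero_add, iteratedDeriv_one, ← deriv_comp_add_const, funext h.add_one, deriv_add_const]
  | succ k ih =>
    intro x
    rw [iteratedDeriv_succ, ← deriv_comp_add_const, funext ih]

theorem edist_S1_le (x y : S1) : edist x y ≤ (1 : ℝ≥0) := by
  rw [edist_dist, dist_eq_norm]
  have := AddCircle.norm_le_half_period (p := (1 : ℝ)) one_ne_zero (x := x - y)
  rw [ENNReal.coe_one, ENNReal.ofReal_le_one]
  norm_num at this
  linarith

theorem diffeos_lipschitz {f : S1 ≃ₜ S1} (hf : f ∈ diffeos 1) :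
    ∃ K : ℝ≥0, HolderWith K 1 f := by
  obtain ⟨⟨F, hF, hF'⟩, -⟩ := hf
  obtain ⟨K, hK⟩ := exists_lipschitzWith (by simpa using hF.periodic 0) hF'
  refine ⟨K, holderWith_one.2 (LipschitzWith.of_dist_le_mul fun x y => ?_)⟩
  obtain ⟨a, rfl⟩ := QuotientAddGroup.mk_surjective x
  obtain ⟨b, rfl⟩ := QuotientAddGroup.mk_surjective y
  set n : ℤ := round (a - b) with hn
  have hb : ((b : ℝ) : S1) = ((b + n : ℝ) : S1) := by
    rw [eq_comm, ← sub_eq_zero, ← AddCircle.coe_sub, AddCircle.coe_eq_zero_iff]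
    exact ⟨n, by simp⟩
  have hd : dist (a : S1) (b : S1) = |a - (b + n)| := by
    rw [dist_eq_norm, ← AddCircle.coe_sub, UnitAddCircle.norm_eq, sub_sub]
  have h1 : dist (f (a : S1)) (f (b : S1)) ≤ |F a - F (b + n)| := by
    rw [hb, ← hF.2.2, ← hF.2.2, dist_eq_norm, ← AddCircle.coe_sub, UnitAddCircle.norm_eq]
    simpa using round_le (F a - F (b + n)) 0
  have h2 := hK.dist_le_mul a (b + n)
  rw [Real.dist_eq, Real.dist_eq] at h2
  change dist (f (a : S1)) (f (b : S1)) ≤ K * dist (a : S1) (b : S1)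
  rw [hd]
  exact h1.trans h2

theorem diffeos_mono {k l : ℕ∞} (h : k ≤ l) : diffeos l ⊆ diffeos k := by
  have h' : (k : WithTop ℕ∞) ≤ (l : WithTop ℕ∞) := by exact_mod_cast h
  rintro f ⟨⟨F, hF, hF'⟩, G, hG, hG'⟩
  exact ⟨⟨F, hF, hF'.of_le h'⟩, G, hG, hG'.of_le h'⟩

theorem orientationPreserving_of_mem_diffeos {k : ℕ∞} {f : S1 ≃ₜ S1} (hf : f ∈ diffeos k) :
    OrientationPreserving f :=
  ⟨hf.1.choose, hf.1.choose_spec.1⟩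

theorem diffeos_subset_holderHomeosWith {β : ℝ≥0} (h1 : β ≤ 1) :
    diffeos 1 ⊆ holderHomeosWith β := fun _ hf =>
  ⟨orientationPreserving_of_mem_diffeos hf, _,
    (diffeos_lipschitz hf).choose_spec.of_le edist_S1_le h1⟩

theorem holderHomeosWith_subset {β : ℝ≥0} (h0 : 0 < β) : holderHomeosWith β ⊆ holderHomeos :=
  fun _ hf => ⟨hf.1, hf.2.choose, β, h0, hf.2.choose_spec⟩

theorem diffeos_subset_holderHomeos {k : ℕ∞} (hk : 1 ≤ k) : diffeos k ⊆ holderHomeos :=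
  (diffeos_mono hk).trans
    ((diffeos_subset_holderHomeosWith le_rfl).trans (holderHomeosWith_subset one_pos))

/-- Hölder homeomorphisms, without a fixed exponent. -/
theorem isRegularityClass_holderHomeos : IsRegularityClass holderHomeos :=
  ⟨diffeos_subset_holderHomeos le_top, subset_rfl⟩

/-- Hölder homeomorphisms with the exponent `β`, `0 < β ≤ 1` (Lipschitz ones for `β = 1`). -/
theorem isRegularityClass_holderHomeosWith {β : ℝ≥0} (h0 : 0 < β) (h1 : β ≤ 1) :
    IsRegularityClass (holderHomeosWith β) :=
  ⟨(diffeos_mono le_top).trans (diffeos_subset_holderHomeosWith h1), holderHomeosWith_subset h0⟩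

/-- Diffeomorphisms of class `C^k`, `1 ≤ k ≤ ∞`. -/
theorem isRegularityClass_diffeos {k : ℕ∞} (hk : 1 ≤ k) : IsRegularityClass (diffeos k) :=
  ⟨diffeos_mono le_top, diffeos_subset_holderHomeos hk⟩

/-- Diffeomorphisms of class `C^{k+β}`, `k ≥ 1`, `0 ≤ β ≤ 1`. -/
theorem isRegularityClass_holderDiffeos {k : ℕ} (hk : 1 ≤ k) {β : ℝ≥0} (h1 : β ≤ 1) :
    IsRegularityClass (holderDiffeos k β) := by
  refine ⟨fun f hf => ⟨diffeos_mono le_top hf, ?_⟩,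
    fun f hf => diffeos_subset_holderHomeos (by exact_mod_cast hk) hf.1⟩
  obtain ⟨⟨F, hF, hF'⟩, -⟩ := hf
  obtain ⟨j, rfl⟩ := Nat.exists_eq_add_of_le' hk
  have hs : ContDiff ℝ 1 (iteratedDeriv (j + 1) F) := by
    rw [iteratedDeriv_eq_iterate]
    exact ContDiff.iterate_deriv' 1 (j + 1) (hF'.of_le (by exact_mod_cast le_top))
  obtain ⟨K, hK⟩ := exists_lipschitzWith (by
    rw [← iteratedDeriv_succ]
    exact hF.periodic (j + 1)) hs
  obtain ⟨R, hR⟩ := ((hF.periodic j).isBounded_of_continuous one_ne_zero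
    hs.continuous).exists_norm_le
  have hb : HolderWith (2 * R.toNNReal) 0 (iteratedDeriv (j + 1) F) := by
    intro x y
    have hx := hR _ ⟨x, rfl⟩
    have hy := hR _ ⟨y, rfl⟩
    have hR0 : 0 ≤ R := (norm_nonneg _).trans hx
    rw [NNReal.coe_zero, ENNReal.rpow_zero, mul_one, edist_le_coe, ← NNReal.coe_le_coe,
      coe_nndist, NNReal.coe_mul, Real.coe_toNNReal _ hR0, NNReal.coe_ofNat]
    exact (dist_le_norm_add_norm _ _).trans (by linarith)
  exact ⟨F, hF, _, hb.of_le_of_le (holderWith_one.2 hK) zero_le h1⟩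

end CircleActions

/-! Eventual equality `E₀` of binary sequences is reduced continuously to `D`-conjugacy, and `E₀`
has no complete numerical Borel invariant.

The reduction is an Anosov–Katok construction. `exists_isTower` chooses diffeomorphisms `h k`, each
commuting with the rotation by `1 / q k`, where `q k` is huge compared with all products of the
earlier ones. A sequence `s` selects a subproduct; its infinite composition `g s` is only a
homeomorphism, but it conjugates very well approximable rotations to smooth diffeomorphisms
(`IsTower.exists_conj_bound`): replacing such a rotation by a multiple of `1 / q k` makes the factor
of level `k` cancel, and the error is too small to be felt in the first derivatives. The rotation
numbers `∑ n (j mod d) / q j` are approximable in this sense, and irrational for `n ≠ 0`, so each `g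
s` yields a free smooth action.

If `s` and `t` agree eventually, `g s` and `g t` differ by a smooth left factor, so the actions are
smoothly conjugate. Otherwise, since only rotations commute with an irrational rotation, any
conjugacy has the form `g s ∘ R_θ ∘ (g t)⁻¹`. At a level `k` with `s k ≠ 0 = t k` the dilation of `h
k` survives and sends points at distance at most `η ^ k` to points at distance at least `η`
(`exists_dilated_pair`). Infinitely many such levels exclude every Hölder exponent.

Finally, an invariant of `E₀` would be almost everywhere constant by ergodicity of the finitely
supported translations of the Cantor group (`not_exists_eventuallyEq_invariant`). -/

namespace CircleActions

open Filter Topology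

/-! ### Lifts of circle homeomorphisms -/

/-- The group of increasing homeomorphisms of the line that commute with the translation by `1`. -/
def degOneIso : Subgroup (ℝ ≃o ℝ) where
  carrier := {f | ∀ x, f (x + 1) = f x + 1}
  one_mem' := fun _ => rfl
  mul_mem' := by
    intro f g hf hg x
    change ∀ x, f (x + 1) = f x + 1 at hf
    change ∀ x, g (x + 1) = g x + 1 at hg
    rw [RelIso.mul_apply, RelIso.mul_apply, hg, hf]
  inv_mem' := by
    intro f hf x
    change ∀ x, f (x + 1) = f x + 1 at hf
    apply f.injective
    rw [hf, RelIso.apply_inv_self, RelIso.apply_inv_self]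

/-- The type of lifts of orientation-preserving circle homeomorphisms. -/
def DegOne : Type := degOneIso

noncomputable instance : Group DegOne := inferInstanceAs (Group degOneIso)

instance : CoeFun DegOne fun _ => ℝ → ℝ := ⟨fun f => f.1⟩

namespace DegOne

@[simp] theorem mul_apply (f g : DegOne) (x : ℝ) : (f * g) x = f (g x) := rfl

@[simp] theorem one_apply (x : ℝ) : (1 : DegOne) x = x := rfl

@[simp] theorem apply_inv (f : DegOne) (x : ℝ) : f (f⁻¹ x) = x :=
  RelIso.apply_inv_self f.1 x

@[simp] theorem inv_apply (f : DegOne) (x : ℝ) : f⁻¹ (f x) = x :=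
  RelIso.inv_apply_self f.1 x

theorem ext' {f g : DegOne} (h : ∀ x, f x = g x) : f = g :=
  Subtype.ext (RelIso.ext h)

theorem add_one (f : DegOne) (x : ℝ) : f (x + 1) = f x + 1 := f.2 x

theorem strictMono (f : DegOne) : StrictMono f := f.1.strictMono

theorem continuous (f : DegOne) : Continuous f := f.1.continuous

/-- The circle map with lift `f`. -/
def circleMap (f : DegOne) : S1 → S1 :=
  Function.Periodic.lift (f := fun x : ℝ => ((f x : ℝ) : S1)) (c := (1 : ℝ)) fun x => by
    change ((f (x + 1) : ℝ) : S1) = ((f x : ℝ) : S1)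
    rw [f.add_one, AddCircle.coe_add_period]

theorem continuous_circleMap (f : DegOne) : Continuous f.circleMap := by
  refine (QuotientAddGroup.isQuotientMap_mk (N := AddSubgroup.zmultiples (1 : ℝ))).continuous_iff.2 ?_
  exact (AddCircle.continuous_mk' (1 : ℝ)).comp f.continuous

theorem circleMap_circleMap (f g : DegOne) (x : S1) :
    f.circleMap (g.circleMap x) = (f * g).circleMap x := by
  obtain ⟨a, rfl⟩ := QuotientAddGroup.mk_surjective x
  rfl

theorem circleMap_one (x : S1) : (1 : DegOne).circleMap x = x := by
  obtain ⟨a, rfl⟩ := QuotientAddGroup.mk_surjective x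
  rfl

/-- The circle homeomorphism with a given lift. -/
noncomputable def toCircle : DegOne →* (S1 ≃ₜ S1) where
  toFun f :=
    { toFun := f.circleMap
      invFun := (f⁻¹).circleMap
      left_inv := fun x => by rw [circleMap_circleMap, inv_mul_cancel, circleMap_one]
      right_inv := fun x => by rw [circleMap_circleMap, mul_inv_cancel, circleMap_one]
      continuous_toFun := f.continuous_circleMap
      continuous_invFun := (f⁻¹).continuous_circleMap }
  map_one' := Homeomorph.ext circleMap_one
  map_mul' f g := Homeomorph.ext fun x => (circleMap_circleMap f g x).symm

@[simp] theorem toCircle_coe (f : DegOne) (x : ℝ) :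
    toCircle f (x : S1) = ((f x : ℝ) : S1) := rfl

theorem toCircle_symm (f : DegOne) : (toCircle f).symm = toCircle f⁻¹ := rfl

theorem isLift (f : DegOne) : IsLift f (toCircle f) :=
  ⟨f.strictMono, f.continuous, fun _ => rfl⟩

/-- The translations of the line. -/
def translation (a : ℝ) : DegOne :=
  ⟨OrderIso.addRight a, fun x => by simp only [OrderIso.addRight_apply]; ring⟩

@[simp] theorem translation_apply (a x : ℝ) : translation a x = x + a := rfl

theorem translation_add (a b : ℝ) : translation (a + b) = translation a * translation b :=
  ext' fun x => by simp only [translation_apply, mul_apply]; ring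

theorem translation_zero : translation 0 = 1 := ext' fun x => by simp

theorem translation_neg (a : ℝ) : translation (-a) = (translation a)⁻¹ := by
  rw [eq_inv_iff_mul_eq_one, ← translation_add, neg_add_cancel, translation_zero]

/-- The lifts of orientation-preserving `C^∞` diffeomorphisms. -/
def smoothIso : Subgroup DegOne where
  carrier := {f | ContDiff ℝ ∞ f ∧ ContDiff ℝ ∞ (f⁻¹ : DegOne)}
  one_mem' := ⟨contDiff_id, contDiff_id⟩
  mul_mem' := by
    rintro f g ⟨hf, hf'⟩ ⟨hg, hg'⟩
    refine ⟨hf.comp hg, ?_⟩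
    rw [mul_inv_rev]
    exact hg'.comp hf'
  inv_mem' := by
    rintro f ⟨hf, hf'⟩
    exact ⟨hf', by rwa [inv_inv]⟩

theorem toCircle_mem_diffeos {f : DegOne} (hf : f ∈ smoothIso) : toCircle f ∈ diffeos ⊤ :=
  ⟨⟨f, f.isLift, hf.1⟩, ⟨(f⁻¹ : DegOne), isLift f⁻¹, hf.2⟩⟩

/-- The derivatives of a lift do not depend on the lift. -/
theorem iteratedDeriv_lift (f : DegOne) (i : ℕ) :
    iteratedDeriv (i + 1) (lift (toCircle f)) = iteratedDeriv (i + 1) f := by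
  have h : IsLift (lift (toCircle f)) (toCircle f) :=
    Classical.epsilon_spec (p := fun F => IsLift F (toCircle f)) ⟨f, f.isLift⟩
  have key : ∀ x, ∃ n : ℤ, (n : ℝ) = lift (toCircle f) x - f x := by
    intro x
    have : ((lift (toCircle f) x : ℝ) : S1) = ((f x : ℝ) : S1) := by
      rw [h.2.2, toCircle_coe]
    rw [← sub_eq_zero, ← AddCircle.coe_sub, AddCircle.coe_eq_zero_iff] at this
    simpa using this
  -- The difference of two lifts is continuous and integer-valued, hence constant.
  choose n hn using key
  have hc : Continuous n := by
    rw [Int.isClosedEmbedding_coe_real.isEmbedding.continuous_iff]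
    have : (Int.cast ∘ n : ℝ → ℝ) = fun x => lift (toCircle f) x - f x := funext hn
    rw [this]
    exact h.2.1.sub f.continuous
  have hconst : ∀ x, n x = n 0 := fun x => PreconnectedSpace.constant inferInstance hc
  have : lift (toCircle f) = fun x => f x + n 0 := by
    funext x
    rw [← hconst x, hn]
    ring
  rw [this, iteratedDeriv_succ', iteratedDeriv_succ', deriv_add_const']

theorem dist_coe_le (x y : ℝ) : dist (x : S1) (y : S1) ≤ |x - y| := by
  rw [dist_eq_norm, ← AddCircle.coe_sub, UnitAddCircle.norm_eq]
  simpa using round_le (x - y) 0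

theorem dist_coe_eq {x y : ℝ} (h : |x - y| ≤ 1 / 2) : dist (x : S1) (y : S1) = |x - y| := by
  rw [dist_eq_norm, ← AddCircle.coe_sub]
  exact (AddCircle.norm_coe_eq_abs_iff (1 : ℝ) one_ne_zero).2 (by simpa using h)

end DegOne


/-! ### Calculus -/

theorem exists_abs_le_of_periodic {f : ℝ → ℝ} (hp : Function.Periodic f 1) (hf : Continuous f) :
    ∃ R : ℝ, 0 ≤ R ∧ ∀ x, |f x| ≤ R := by
  obtain ⟨R, hR⟩ := (hp.isBounded_of_continuous one_ne_zero hf).exists_norm_le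
  exact ⟨R, (norm_nonneg _).trans (hR _ ⟨0, rfl⟩), fun x => hR _ ⟨x, rfl⟩⟩

theorem periodic_deriv_of_periodic {f : ℝ → ℝ} (hp : Function.Periodic f 1) :
    Function.Periodic (deriv f) 1 := fun x => by
  rw [← deriv_comp_add_const, funext hp]

theorem periodic_deriv_of_add_one {f : ℝ → ℝ} (hp : ∀ x, f (x + 1) = f x + 1) :
    Function.Periodic (deriv f) 1 := fun x => by
  rw [← deriv_comp_add_const, funext hp, deriv_add_const]

theorem contDiff_deriv {f : ℝ → ℝ} (hf : ContDiff ℝ ∞ f) : ContDiff ℝ ∞ (deriv f) :=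
  ((contDiff_infty_iff_deriv).1 hf).2

theorem differentiable_of_smooth {f : ℝ → ℝ} (hf : ContDiff ℝ ∞ f) : Differentiable ℝ f :=
  ((contDiff_infty_iff_deriv).1 hf).1

/-- The derivatives of `y ↦ A (u y + β) * B y` are Lipschitz in the parameter `β`. -/
theorem exists_iteratedDeriv_shift_lipschitz {u : ℝ → ℝ} (hu : ContDiff ℝ ∞ u)
    (hu1 : ∀ x, u (x + 1) = u x + 1) (r : ℕ) :
    ∀ A B : ℝ → ℝ, ContDiff ℝ ∞ A → Function.Periodic (deriv A) 1 → ContDiff ℝ ∞ B →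
      Function.Periodic B 1 → ∃ C : ℝ, 0 ≤ C ∧ ∀ β γ x,
        |iteratedDeriv r (fun y => A (u y + β) * B y) x -
          iteratedDeriv r (fun y => A (u y + γ) * B y) x| ≤ C * |β - γ| := by
  induction r with
  | zero =>
    intro A B hA hA' hB hB'
    obtain ⟨K, hK⟩ := exists_lipschitzWith hA' (hA.of_le (by exact_mod_cast le_top))
    obtain ⟨R, hR0, hR⟩ := exists_abs_le_of_periodic hB' hB.continuous
    refine ⟨K * R, by positivity, fun β γ x => ?_⟩
    have := hK.dist_le_mul (u x + β) (u x + γ)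
    rw [Real.dist_eq, Real.dist_eq, add_sub_add_left_eq_sub] at this
    rw [iteratedDeriv_zero, iteratedDeriv_zero, ← sub_mul, abs_mul]
    calc _ ≤ (K * |β - γ|) * R := by gcongr; exact hR x
      _ = _ := by ring
  | succ r ih =>
    intro A B hA hA' hB hB'
    -- Products of this shape are closed under differentiation up to sums, which is why the factor
    -- `B` is carried along. Only `deriv A` is assumed periodic, so that `A` may itself be a lift.
    obtain ⟨C₁, h₁, H₁⟩ := ih (deriv A) (fun y => deriv u y * B y) (contDiff_deriv hA)
      (periodic_deriv_of_periodic hA') ((contDiff_deriv hu).mul hB)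
      ((periodic_deriv_of_add_one hu1).mul hB')
    obtain ⟨C₂, h₂, H₂⟩ := ih A (deriv B) hA hA' (contDiff_deriv hB)
      (periodic_deriv_of_periodic hB')
    have key : ∀ β x, iteratedDeriv (r + 1) (fun y => A (u y + β) * B y) x =
        iteratedDeriv r (fun y => deriv A (u y + β) * (deriv u y * B y)) x +
          iteratedDeriv r (fun y => A (u y + β) * deriv B y) x := by
      intro β x
      have hd : deriv (fun y => A (u y + β) * B y) = fun y =>
          deriv A (u y + β) * (deriv u y * B y) + A (u y + β) * deriv B y := by
        funext y
        have e1 : HasDerivAt (fun y => u y + β) (deriv u y) y :=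
          (differentiable_of_smooth hu y).hasDerivAt.add_const β
        have e2 := ((differentiable_of_smooth hA (u y + β)).hasDerivAt.comp y e1).mul
          (differentiable_of_smooth hB y).hasDerivAt
        refine e2.deriv.trans ?_
        simp only [Function.comp]
        ring
      rw [iteratedDeriv_succ', hd]
      have s1 : ContDiff ℝ ∞ (fun y => u y + β) := hu.add contDiff_const
      refine iteratedDeriv_fun_add ?_ ?_
      · exact ((((contDiff_deriv hA).comp s1).mul ((contDiff_deriv hu).mul hB)).of_le
          (by exact_mod_cast le_top)).contDiffAt
      · exact (((hA.comp s1).mul (contDiff_deriv hB)).of_le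
          (by exact_mod_cast le_top)).contDiffAt
    refine ⟨C₁ + C₂, by positivity, fun β γ x => ?_⟩
    rw [key, key, add_sub_add_comm, add_mul]
    exact (abs_add_le _ _).trans (add_le_add (H₁ β γ x) (H₂ β γ x))

/-- A sequence of smooth functions all of whose derivatives converge geometrically has a smooth
limit, with convergence of all derivatives. -/
theorem smooth_limit {f : ℕ → ℝ → ℝ} {g : ℝ → ℝ} {M : ℝ} (hf : ∀ k, ContDiff ℝ ∞ (f k))
    (h : ∀ r k, r ≤ k → ∀ x,
      |iteratedDeriv r (f (k + 1)) x - iteratedDeriv r (f k) x| ≤ M / 2 / 2 ^ k)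
    (hg : ∀ x, Tendsto (fun k => f k x) atTop (𝓝 (g x))) :
    ContDiff ℝ ∞ g ∧ ∀ r k, r ≤ k → ∀ x,
      |iteratedDeriv r g x - iteratedDeriv r (f k) x| ≤ M / 2 ^ k := by
  have hlim : ∀ r x, ∃ y, Tendsto (fun k => iteratedDeriv r (f k) x) atTop (𝓝 y) ∧
      ∀ k, r ≤ k → |y - iteratedDeriv r (f k) x| ≤ M / 2 ^ k := by
    intro r x
    -- The `r`-th derivatives are controlled only from index `r` on, hence the shift.
    have hb : ∀ k, dist (iteratedDeriv r (f (k + r)) x) (iteratedDeriv r (f (k + 1 + r)) x) ≤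
        M / 2 ^ r / 2 / 2 ^ k := by
      intro k
      rw [dist_comm, Real.dist_eq, show k + 1 + r = k + r + 1 by ring]
      refine (h r (k + r) (by omega) x).trans (le_of_eq ?_)
      rw [pow_add]
      field_simp
    obtain ⟨y, hy⟩ := cauchySeq_tendsto_of_complete (cauchySeq_of_le_geometric_two hb)
    refine ⟨y, (tendsto_add_atTop_iff_nat r).1 hy, fun k hk => ?_⟩
    have := dist_le_of_le_geometric_two_of_tendsto hb hy (k - r)
    rw [Nat.sub_add_cancel hk, dist_comm, Real.dist_eq] at this
    refine this.trans (le_of_eq ?_)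
    rw [div_div, ← pow_add, Nat.add_sub_cancel' hk]
  choose G hG hGb using hlim
  have hM : 0 ≤ M := by
    have := (abs_nonneg _).trans (hGb 0 0 0 le_rfl)
    simpa using this
  have hunif : ∀ r, TendstoUniformly (fun k => iteratedDeriv r (f k)) (G r) atTop := by
    intro r
    rw [Metric.tendstoUniformly_iff]
    intro e he
    have h0 : Tendsto (fun k : ℕ => M / 2 ^ k) atTop (𝓝 0) :=
      tendsto_const_nhds.div_atTop (tendsto_pow_atTop_atTop_of_one_lt one_lt_two)
    filter_upwards [h0.eventually_lt_const he, eventually_ge_atTop r] with k hk hrk x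
    exact (hGb r x k hrk).trans_lt hk
  have hder : ∀ r x, HasDerivAt (G r) (G (r + 1) x) x := by
    intro r x
    refine hasDerivAt_of_tendstoUniformly (hunif (r + 1)) (Eventually.of_forall fun k y => ?_)
      (fun y => hG r y) x
    rw [iteratedDeriv_succ]
    refine (DifferentiableAt.hasDerivAt ?_)
    exact (hf k).differentiable_iteratedDeriv r (by exact_mod_cast ENat.natCast_lt_top r) y
  have hG0 : G 0 = g := funext fun x => tendsto_nhds_unique (hG 0 x) (by simpa using hg x)
  have hit : ∀ r, iteratedDeriv r g = G r := by
    intro r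
    induction r with
    | zero => rw [iteratedDeriv_zero, hG0]
    | succ r ih => rw [iteratedDeriv_succ, ih]; exact funext fun x => (hder r x).deriv
  refine ⟨contDiff_of_differentiable_iteratedDeriv fun m _ => ?_, fun r k hk x => ?_⟩
  · rw [hit]
    exact fun x => (hder m x).differentiableAt
  · rw [hit]
    exact hGb r x k hk


/-! ### Diffeomorphisms with a strong dilation -/

/-- A lift of the boundary map of a hyperbolic isometry of the disc. -/
noncomputable def moebius (a x : ℝ) : ℝ :=
  x + Real.arctan (a * Real.sin (2 * Real.pi * x) / (1 - a * Real.cos (2 * Real.pi * x))) / Real.pi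

theorem one_sub_mul_cos_pos {a : ℝ} (h0 : 0 ≤ a) (h1 : a < 1) (θ : ℝ) :
    0 < 1 - a * Real.cos θ := by
  nlinarith [Real.cos_le_one θ, Real.neg_one_le_cos θ]

theorem contDiff_moebius {a : ℝ} (h0 : 0 ≤ a) (h1 : a < 1) : ContDiff ℝ ∞ (moebius a) := by
  have e : ContDiff ℝ ∞ fun x : ℝ => 2 * Real.pi * x := contDiff_const.mul contDiff_id
  refine contDiff_id.add (ContDiff.div_const (Real.contDiff_arctan.comp ?_) _)
  exact (contDiff_const.mul (Real.contDiff_sin.comp e)).div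
    (contDiff_const.sub (contDiff_const.mul (Real.contDiff_cos.comp e)))
    fun x => (one_sub_mul_cos_pos h0 h1 _).ne'

theorem hasDerivAt_moebius {a : ℝ} (h0 : 0 ≤ a) (h1 : a < 1) (x : ℝ) :
    ∃ m, 0 < m ∧ HasDerivAt (moebius a) m x := by
  set θ := 2 * Real.pi * x with hθ
  have hv := one_sub_mul_cos_pos h0 h1 θ
  have e : HasDerivAt (fun x : ℝ => 2 * Real.pi * x) (2 * Real.pi) x := by
    simpa using (hasDerivAt_id x).const_mul (2 * Real.pi)
  have hs : HasDerivAt (fun x => a * Real.sin (2 * Real.pi * x))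
      (a * (Real.cos θ * (2 * Real.pi))) x := e.sin.const_mul a
  have hc : HasDerivAt (fun x => 1 - a * Real.cos (2 * Real.pi * x))
      (-(a * (-Real.sin θ * (2 * Real.pi)))) x := (e.cos.const_mul a).const_sub 1
  have hd : HasDerivAt
      (fun x => a * Real.sin (2 * Real.pi * x) / (1 - a * Real.cos (2 * Real.pi * x)))
      ((a * (Real.cos θ * (2 * Real.pi)) * (1 - a * Real.cos θ) -
        a * Real.sin θ * -(a * (-Real.sin θ * (2 * Real.pi)))) / (1 - a * Real.cos θ) ^ 2) x :=
    hs.fun_div hc hv.ne'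
  have hm : HasDerivAt (moebius a) _ x := (hasDerivAt_id x).add (hd.arctan.div_const Real.pi)
  rw [← hθ] at hm
  set S := Real.sin θ
  set K := Real.cos θ
  have hsc : S ^ 2 + K ^ 2 = 1 := Real.sin_sq_add_cos_sq θ
  have hp := Real.pi_pos
  -- This is the Poisson kernel; the denominator is `|1 - a e^{iθ}|²`.
  refine ⟨(1 - a ^ 2) / ((1 - a * K) ^ 2 + (a * S) ^ 2), ?_, hm.congr_deriv ?_⟩
  rotate_left
  · have h2 : 1 + (a * S / (1 - a * K)) ^ 2 =
      ((1 - a * K) ^ 2 + (a * S) ^ 2) / (1 - a * K) ^ 2 := by field_simp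
    rw [h2]
    field_simp
    have : S ^ 2 = 1 - K ^ 2 := by linarith
    rw [this]
    ring
  have : 0 < 1 - a ^ 2 := by nlinarith
  positivity

theorem moebius_add_one (a x : ℝ) : moebius a (x + 1) = moebius a x + 1 := by
  unfold moebius
  rw [mul_add, mul_one, Real.sin_add_two_pi, Real.cos_add_two_pi]
  ring

theorem abs_moebius_sub_le (a x : ℝ) : |moebius a x - x| ≤ 1 / 2 := by
  have hp := Real.pi_pos
  have h : ∀ y, |Real.arctan y / Real.pi| ≤ 1 / 2 := by
    intro y
    rw [abs_div, abs_of_pos hp, div_le_iff₀ hp, abs_le]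
    constructor <;> linarith [Real.neg_pi_div_two_lt_arctan y, Real.arctan_lt_pi_div_two y]
  unfold moebius
  rw [add_sub_cancel_left]
  exact h _

theorem moebius_neg (a x : ℝ) : moebius a (-x) = -moebius a x := by
  unfold moebius
  rw [mul_neg, Real.sin_neg, Real.cos_neg, mul_neg, neg_div, Real.arctan_neg]
  ring

/-- As `a → 1` the maps degenerate to the constant `1 / 2` on `(0, 1)`, because `sin 2πe / (1 - cos
2πe) = cot πe`. Continuity in `a` at `1` then provides an `a < 1`. -/
theorem exists_moebius_ge {e : ℝ} (h0 : 0 < e) (h1 : e < 1 / 2) :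
    ∃ a, 0 ≤ a ∧ a < 1 ∧ 1 / 4 ≤ moebius a e := by
  have hp := Real.pi_pos
  have hsin : 0 < Real.sin (Real.pi * e) := Real.sin_pos_of_pos_of_lt_pi (by positivity) (by nlinarith)
  have hcos : 0 < Real.cos (Real.pi * e) :=
    Real.cos_pos_of_mem_Ioo ⟨by nlinarith, by nlinarith⟩
  have h2 : 2 * Real.pi * e = 2 * (Real.pi * e) := by ring
  have hne : 1 - 1 * Real.cos (2 * Real.pi * e) ≠ 0 := by
    rw [h2, Real.cos_two_mul]
    nlinarith [Real.sin_sq_add_cos_sq (Real.pi * e)]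
  have hc : ContinuousAt (fun a => moebius a e) 1 := by
    unfold moebius
    refine continuousAt_const.add (ContinuousAt.div_const ?_ _)
    refine Real.continuous_arctan.continuousAt.comp ?_
    exact (continuousAt_id.mul continuousAt_const).div
      (continuousAt_const.sub (continuousAt_id.mul continuousAt_const)) hne
  have h1' : moebius 1 e = 1 / 2 := by
    have : 1 * Real.sin (2 * Real.pi * e) / (1 - 1 * Real.cos (2 * Real.pi * e)) =
        Real.tan (Real.pi / 2 - Real.pi * e) := by
      rw [Real.tan_pi_div_two_sub, Real.tan_eq_sin_div_cos, h2, Real.sin_two_mul, one_mul, one_mul,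
        Real.cos_two_mul, Real.cos_sq', inv_div, div_eq_div_iff (by nlinarith) hsin.ne']
      ring
    unfold moebius
    rw [this, Real.arctan_tan (by nlinarith) (by nlinarith)]
    field_simp
    ring
  have hev : ∀ᶠ a in 𝓝 (1 : ℝ), 1 / 4 < moebius a e :=
    hc.eventually (lt_mem_nhds (by
      change 1 / 4 < moebius 1 e
      rw [h1']
      norm_num))
  have hev' : ∀ᶠ a in 𝓝[<] (1 : ℝ), 1 / 4 < moebius a e := hev.filter_mono nhdsWithin_le_nhds
  obtain ⟨a, ha, ha0, ha1⟩ := (hev'.and (Ioo_mem_nhdsLT (show (0 : ℝ) < 1 by norm_num))).exists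
  exact ⟨a, ha0.le, ha1, ha.le⟩

/-- A smooth diffeomorphism of the line with positive derivative that commutes with the translation
by `1` defines a smooth lift. -/
theorem exists_smoothIso {F : ℝ → ℝ} (hF : ContDiff ℝ ∞ F) (h1 : ∀ x, F (x + 1) = F x + 1)
    (hd : ∀ x, ∃ m, 0 < m ∧ HasDerivAt F m x) (hb : ∀ x, |F x - x| ≤ 1) :
    ∃ f ∈ DegOne.smoothIso, ∀ x, f x = F x := by
  choose m hm0 hm using hd
  have hmono : StrictMono F := strictMono_of_deriv_pos fun x => by rw [(hm x).deriv]; exact hm0 x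
  have hsurj : Function.Surjective F := by
    refine hF.continuous.surjective ?_ ?_
    · refine tendsto_atTop_mono (fun x => ?_) (tendsto_atTop_add_const_right _ (-1) tendsto_id)
      have := (abs_le.1 (hb x)).1
      simp only [id]
      linarith
    · refine tendsto_atBot_mono (fun x => ?_) (tendsto_atBot_add_const_right _ 1 tendsto_id)
      have := (abs_le.1 (hb x)).2
      simp only [id]
      linarith
  let e := StrictMono.orderIsoOfSurjective F hmono hsurj
  let f : DegOne := ⟨e, h1⟩
  refine ⟨f, ⟨hF, ?_⟩, fun x => rfl⟩
  exact e.toHomeomorph.contDiff_symm_deriv (fun x => (hm0 x).ne') hm hF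

/-- For all `q` and `e` some diffeomorphism that commutes with the rotation by `1 / q` and is
`1 / q`-close to the identity dilates `[-e, e]` to length at least `1 / (2 q)`. -/
theorem exists_dilation {q : ℕ} (hq : 0 < q) {e : ℝ} (he : 0 < e) :
    ∃ h ∈ DegOne.smoothIso, (∀ x, h (x + 1 / q) = h x + 1 / q) ∧
      (∀ x, |h x - x| ≤ 1 / q) ∧ 1 / (2 * q) ≤ h e - h (-e) := by
  have hq' : (0 : ℝ) < q := by exact_mod_cast hq
  obtain ⟨e', he', hee', hhalf⟩ : ∃ e' : ℝ, 0 < e' ∧ e' ≤ q * e ∧ e' < 1 / 2 :=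
    ⟨min (q * e) (1 / 4), lt_min (by positivity) (by norm_num), min_le_left _ _,
      (min_le_right _ _).trans_lt (by norm_num)⟩
  obtain ⟨a, ha0, ha1, ha⟩ := exists_moebius_ge he' hhalf
  have hper : ∀ n : ℕ, ∀ x, moebius a (x + n) = moebius a x + n := by
    intro n
    induction n with
    | zero => intro x; simp
    | succ n ih =>
      intro x
      rw [Nat.cast_succ, ← add_assoc, moebius_add_one, ih, add_assoc]
  have hclose : ∀ x, |moebius a (q * x) / q - x| ≤ 1 / q := by
    intro x
    have : moebius a (q * x) / q - x = (moebius a (q * x) - q * x) / q := by field_simp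
    rw [this, abs_div, abs_of_pos hq']
    gcongr
    exact (abs_moebius_sub_le _ _).trans (by norm_num)
  -- Lifting the Möbius map to the `q`-fold cover of the circle makes it commute with the rotation
  -- by `1 / q` and divides displacements by `q`.
  obtain ⟨h, hs, hh⟩ := exists_smoothIso (F := fun x => moebius a (q * x) / q)
    (((contDiff_moebius ha0 ha1).comp (contDiff_const.mul contDiff_id)).div_const _)
    (fun x => by
      rw [mul_add, mul_one, hper]
      field_simp)
    (fun x => by
      obtain ⟨m, hm0, hm⟩ := hasDerivAt_moebius ha0 ha1 (q * x)
      have e1 : HasDerivAt (fun x : ℝ => q * x) q x := by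
        simpa using (hasDerivAt_id x).const_mul (q : ℝ)
      exact ⟨m * q / q, by positivity, (hm.comp x e1).div_const _⟩)
    (fun x => (hclose x).trans (by
      rw [div_le_one hq']
      exact_mod_cast hq))
  refine ⟨h, hs, fun x => ?_, fun x => by rw [hh]; exact hclose x, ?_⟩
  · rw [hh, hh, mul_add, mul_one_div_cancel hq'.ne', moebius_add_one, add_div]
  · have hle : e' / q ≤ e := by rw [div_le_iff₀ hq']; linarith
    have h2 : h (e' / q) - h (-(e' / q)) ≤ h e - h (-e) :=
      sub_le_sub (h.strictMono.monotone hle) (h.strictMono.monotone (neg_le_neg hle))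
    refine le_trans ?_ h2
    rw [hh, hh, mul_neg, moebius_neg, mul_div_cancel₀ _ hq'.ne', ← sub_div,
      div_le_div_iff₀ (by positivity) hq']
    nlinarith

open DegOne

/-! ### Towers of diffeomorphisms -/

/-- The conjugate of a translation by `f`. -/
noncomputable def conjTranslation (f : DegOne) (β : ℝ) : DegOne := f * translation β * f⁻¹

theorem conjTranslation_apply (f : DegOne) (β x : ℝ) :
    conjTranslation f β x = f (f⁻¹ x + β) := rfl

theorem conjTranslation_add (f : DegOne) (β γ : ℝ) :
    conjTranslation f (β + γ) = conjTranslation f β * conjTranslation f γ := by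
  simp only [conjTranslation, translation_add]
  group

theorem conjTranslation_zero (f : DegOne) : conjTranslation f 0 = 1 := by
  simp [conjTranslation, translation_zero]

theorem conjTranslation_neg (f : DegOne) (β : ℝ) :
    conjTranslation f (-β) = (conjTranslation f β)⁻¹ := by
  rw [eq_inv_iff_mul_eq_one, ← conjTranslation_add, neg_add_cancel, conjTranslation_zero]

theorem translation_mem_smoothIso (a : ℝ) : translation a ∈ smoothIso := by
  refine ⟨contDiff_id.add contDiff_const, ?_⟩
  rw [← translation_neg]
  exact contDiff_id.add contDiff_const

theorem conjTranslation_mem_smoothIso {f : DegOne} (hf : f ∈ smoothIso) (β : ℝ) :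
    conjTranslation f β ∈ smoothIso :=
  mul_mem (mul_mem hf (translation_mem_smoothIso β)) (inv_mem hf)

/-- The derivatives up to order `k` of the conjugates of the translations by `f` are
`C`-Lipschitz in the translation length. -/
def ConjLipschitz (f : DegOne) (k : ℕ) (C : ℝ) : Prop :=
  ∀ r ≤ k, ∀ β γ x, |iteratedDeriv r (conjTranslation f β) x -
    iteratedDeriv r (conjTranslation f γ) x| ≤ C * |β - γ|

/-- Both `f` and its inverse are `L`-Lipschitz. -/
def BiLipschitz (f : DegOne) (L : ℝ) : Prop :=
  ∀ x y, |f x - f y| ≤ L * |x - y| ∧ |(f⁻¹ : DegOne) x - (f⁻¹ : DegOne) y| ≤ L * |x - y|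

theorem eventually_conjLipschitz {f : DegOne} (hf : f ∈ smoothIso) (k : ℕ) :
    ∀ᶠ C in atTop, ConjLipschitz f k C := by
  refine (Filter.eventually_all_finite (Set.finite_Iic k)).2 fun r _ => ?_
  obtain ⟨C, hC, h⟩ := exists_iteratedDeriv_shift_lipschitz hf.2 (f⁻¹).add_one r f 1 hf.1
    (periodic_deriv_of_add_one f.add_one) contDiff_const (fun _ => rfl)
  filter_upwards [eventually_ge_atTop C] with C' hC' β γ x
  simp only [Pi.one_apply, mul_one] at h
  exact (h β γ x).trans (by gcongr)

theorem exists_lipschitz {f : DegOne} (hf : ContDiff ℝ ∞ f) :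
    ∃ K : ℝ, ∀ x y, |f x - f y| ≤ K * |x - y| := by
  obtain ⟨K, hK⟩ := exists_lipschitzWith (periodic_deriv_of_add_one f.add_one)
    (hf.of_le (by exact_mod_cast le_top))
  exact ⟨K, fun x y => hK.dist_le_mul x y⟩

theorem eventually_biLipschitz {f : DegOne} (hf : f ∈ smoothIso) :
    ∀ᶠ L in atTop, BiLipschitz f L := by
  obtain ⟨K, hK⟩ := exists_lipschitz hf.1
  obtain ⟨K', hK'⟩ := exists_lipschitz hf.2
  filter_upwards [eventually_ge_atTop K, eventually_ge_atTop K'] with L h h' x y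
  exact ⟨(hK x y).trans (by gcongr), (hK' x y).trans (by gcongr)⟩

/-- The relation between the data `(q, h, ε)` of level `k` of a tower and the set `F` of products of
diffeomorphisms of lower levels and the data `Q`, `e` of the previous level. -/
structure IsStep (k : ℕ) (F : Set DegOne) (Q : ℕ) (e : ℝ) (q : ℕ) (h : DegOne) (ε : ℝ) :
    Prop where
  pos : 0 < q
  dvd : Q ∣ q
  growth : (k + 2) * Q ≤ q
  div_le : 16 / e ≤ q
  eps_pos : 0 < ε
  smooth : h ∈ smoothIso
  commute : ∀ x, h (x + 1 / q) = h x + 1 / q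
  near : ∀ x, |h x - x| ≤ 1 / q
  dilation : 1 / (2 * q) ≤ h ε - h (-ε)
  conjLipschitz : ∀ f ∈ F, ConjLipschitz f k (q / 4 ^ k)
  biLipschitz : ∃ L : ℝ, 1 ≤ L ∧ L * 2 ^ k * 16 ≤ q ∧ 3 * L * ε ≤ (1 / (2 * q * L)) ^ k ∧
    ∀ f ∈ F, BiLipschitz f L

/-- The choices are not circular: `L` depends on `F` only, then `q` is a large multiple of `Q`, then
`ε` depends on `q` and `L`, and `h` comes last. -/
theorem exists_isStep (k : ℕ) {F : Set DegOne} (hF : F.Finite) (hFs : ∀ f ∈ F, f ∈ smoothIso)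
    {Q : ℕ} (hQ : 0 < Q) (e : ℝ) : ∃ q h ε, IsStep k F Q e q h ε := by
  obtain ⟨L, hL, hL1⟩ := (((Filter.eventually_all_finite hF).2 fun f hf =>
    eventually_biLipschitz (hFs f hf)).and (eventually_ge_atTop (1 : ℝ))).exists
  have hC := ((Filter.eventually_all_finite hF).2 fun f hf =>
    eventually_conjLipschitz (hFs f hf) k)
  have t1 : Tendsto (fun m : ℕ => ((Q * m : ℕ) : ℝ)) atTop atTop :=
    tendsto_natCast_atTop_atTop.comp (tendsto_id.const_mul_atTop' hQ)
  have t2 : Tendsto (fun m : ℕ => ((Q * m : ℕ) : ℝ) / 4 ^ k) atTop atTop :=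
    t1.atTop_div_const (by positivity)
  obtain ⟨m, hm1, hm2, hm3, hm4⟩ := ((t2.eventually hC).and ((t1.eventually_ge_atTop (16 / e)).and
    ((t1.eventually_ge_atTop (L * 2 ^ k * 16)).and (eventually_ge_atTop (k + 2))))).exists
  have hpos : 0 < Q * m := Nat.mul_pos hQ (by omega)
  have hpos' : (0 : ℝ) < (Q * m : ℕ) := by exact_mod_cast hpos
  generalize hq : Q * m = q at *
  have hε : 0 < (1 / (2 * q * L)) ^ k / (3 * L) := by positivity
  obtain ⟨h, h1, h2, h3, h4⟩ := exists_dilation hpos hε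
  refine ⟨q, h, _, hpos, ⟨m, hq.symm⟩, ?_, hm2, hε, h1, h2, h3, h4, hm1, L, hL1, hm3, ?_, hL⟩
  · rw [← hq, mul_comm]
    exact Nat.mul_le_mul_left _ hm4
  · exact (mul_div_cancel₀ _ (by positivity)).le

/-- The product of the `h j`, `j < k`, with `s j ≠ 0`. -/
noncomputable def partialProd (h : ℕ → DegOne) (s : ℕ → ZMod 2) : ℕ → DegOne
  | 0 => 1
  | k + 1 => partialProd h s k * if s k = 0 then 1 else h k

/-- A sequence of diffeomorphisms `h k`, each chosen after the previous ones, that commute with the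
rotations by `1 / q k`. -/
structure IsTower (q : ℕ → ℕ) (h : ℕ → DegOne) (ε : ℕ → ℝ) : Prop where
  zero : IsStep 0 (Set.range fun s => partialProd h s 0) 1 1 (q 0) (h 0) (ε 0)
  succ : ∀ k, IsStep (k + 1) (Set.range fun s => partialProd h s (k + 1)) (q k) (ε k)
    (q (k + 1)) (h (k + 1)) (ε (k + 1))

theorem IsStep.mono {k : ℕ} {F F' : Set DegOne} {Q : ℕ} {e : ℝ} {q : ℕ} {h : DegOne} {ε : ℝ}
    (H : IsStep k F Q e q h ε) (hF : F' ⊆ F) : IsStep k F' Q e q h ε :=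
  { H with
    conjLipschitz := fun f hf => H.conjLipschitz f (hF hf)
    biLipschitz := by
      obtain ⟨L, h1, h2, h3, h4⟩ := H.biLipschitz
      exact ⟨L, h1, h2, h3, fun f hf => h4 f (hF hf)⟩ }

theorem exists_isTower : ∃ q h ε, IsTower q h ε := by
  -- Each choice depends on all products of earlier factors, so the recursion carries a finite set
  -- containing them, together with the previous `q` and `ε`.
  let State := {F : Set DegOne // F.Finite ∧ ∀ f ∈ F, f ∈ smoothIso} × {Q : ℕ // 0 < Q} × ℝ
  have step : ∀ (k : ℕ) (S : State), ∃ q h ε, IsStep k S.1.1 S.2.1.1 S.2.2 q h ε := fun k S =>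
    exists_isStep k S.1.2.1 S.1.2.2 S.2.1.2 S.2.2
  choose q h ε hs using step
  let next : ℕ → State → State := fun k S =>
    (⟨S.1.1 ∪ (fun f => f * h k S) '' S.1.1, S.1.2.1.union (S.1.2.1.image _), by
      rintro f (hf | ⟨g, hg, rfl⟩)
      · exact S.1.2.2 f hf
      · exact mul_mem (S.1.2.2 g hg) (hs k S).smooth⟩, ⟨q k S, (hs k S).pos⟩, ε k S)
  let S : ℕ → State := Nat.rec
    (⟨{1}, Set.finite_singleton _, by
      rintro f rfl
      exact one_mem _⟩, ⟨1, one_pos⟩, 1) next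
  have hsub : ∀ k, (Set.range fun s => partialProd (fun k => h k (S k)) s k) ⊆ (S k).1.1 := by
    intro k
    induction k with
    | zero =>
      rintro _ ⟨s, rfl⟩
      rfl
    | succ k ih =>
      rintro _ ⟨s, rfl⟩
      change partialProd (fun k => h k (S k)) s (k + 1) ∈
        (S k).1.1 ∪ (fun f => f * h k (S k)) '' (S k).1.1
      have hk := ih ⟨s, rfl⟩
      by_cases h0 : s k = 0
      · left
        simpa [partialProd, h0] using hk
      · right
        exact ⟨_, hk, by simp [partialProd, h0]⟩
  exact ⟨fun k => q k (S k), fun k => h k (S k), fun k => ε k (S k),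
    (hs 0 (S 0)).mono (hsub 0), fun k => (hs (k + 1) (S (k + 1))).mono (hsub (k + 1))⟩


/-! ### Limits of towers -/

theorem DegOne.tendsto_of_close {f : ℕ → DegOne} {g : ℝ → ℝ} {b : ℕ → ℝ}
    (hb : Tendsto b atTop (𝓝 0)) (h : ∀ k x, |g x - f k x| ≤ b k) :
    TendstoUniformly (fun k => (f k : ℝ → ℝ)) g atTop := by
  rw [Metric.tendstoUniformly_iff]
  intro e he
  filter_upwards [hb.eventually_lt_const he] with k hk x
  exact (h k x).trans_lt hk

/-- Uniform limits of lifts, provided that the inverses converge as well. -/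
theorem DegOne.exists_limit {f : ℕ → DegOne} {b : ℕ → ℝ} (hb : Tendsto b atTop (𝓝 0))
    (h : ∀ k n x, |f (k + n) x - f k x| ≤ b k)
    (h' : ∀ k n x, |(f (k + n))⁻¹ x - (f k)⁻¹ x| ≤ b k) :
    ∃ g : DegOne, (∀ k x, |g x - f k x| ≤ b k) ∧ ∀ k x, |g⁻¹ x - (f k)⁻¹ x| ≤ b k := by
  have lim : ∀ f : ℕ → DegOne, (∀ k n x, |f (k + n) x - f k x| ≤ b k) →
      ∃ g : ℝ → ℝ, ∀ x, Tendsto (fun k => f k x) atTop (𝓝 (g x)) := by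
    intro f h
    have : ∀ x, ∃ y, Tendsto (fun k => f k x) atTop (𝓝 y) := fun x => by
      refine cauchySeq_tendsto_of_complete (cauchySeq_of_le_tendsto_0' b (fun k m hkm => ?_) hb)
      obtain ⟨n, rfl⟩ := Nat.exists_eq_add_of_le hkm
      rw [dist_comm]
      exact h k n x
    choose g hg using this
    exact ⟨g, hg⟩
  have close : ∀ (f : ℕ → DegOne) (g : ℝ → ℝ), (∀ k n x, |f (k + n) x - f k x| ≤ b k) →
      (∀ x, Tendsto (fun k => f k x) atTop (𝓝 (g x))) → ∀ k x, |g x - f k x| ≤ b k := by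
    intro f g h hg k x
    refine le_of_tendsto ((((hg x).comp (tendsto_add_atTop_nat k)).sub_const _).abs)
      (Eventually.of_forall fun n => ?_)
    rw [Function.comp, add_comm n k]
    exact h k n x
  -- A uniform limit of homeomorphisms may fail to be injective; convergence of the inverses
  -- supplies a two-sided inverse of the limit.
  have inv : ∀ (f f' : ℕ → DegOne) (g g' : ℝ → ℝ), (∀ k x, f k (f' k x) = x) →
      (∀ k x, |g x - f k x| ≤ b k) → (∀ x, Tendsto (fun k => f' k x) atTop (𝓝 (g' x))) →
      ∀ x, g (g' x) = x := by
    intro f f' g g' hff hg hg' x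
    have hu := tendsto_of_close hb hg
    have hc : Continuous g := hu.continuous (Frequently.of_forall fun k => (f k).continuous)
    refine tendsto_nhds_unique (hu.tendsto_comp hc.continuousAt (hg' x)) ?_
    simp only [hff]
    exact tendsto_const_nhds
  have mono : ∀ (f : ℕ → DegOne) (g : ℝ → ℝ),
      (∀ x, Tendsto (fun k => f k x) atTop (𝓝 (g x))) → Monotone g := fun f g hg x y hxy =>
    le_of_tendsto_of_tendsto' (hg x) (hg y) fun k => (f k).strictMono.monotone hxy
  obtain ⟨g, hg⟩ := lim f h
  obtain ⟨g', hg'⟩ := lim (fun k => (f k)⁻¹) h'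
  have c := close f g h hg
  have c' := close (fun k => (f k)⁻¹) g' h' hg'
  let e : ℝ ≃ ℝ :=
    { toFun := g
      invFun := g'
      left_inv := inv (fun k => (f k)⁻¹) f g' g (fun k x => inv_apply _ x) c' hg
      right_inv := inv f (fun k => (f k)⁻¹) g g' (fun k x => apply_inv _ x) c hg' }
  have h1 : ∀ x, g (x + 1) = g x + 1 := fun x =>
    tendsto_nhds_unique (hg (x + 1)) (by
      simp only [DegOne.add_one]
      exact (hg x).add_const 1)
  exact ⟨⟨e.toOrderIso (mono f g hg) (mono _ g' hg'), h1⟩, c, c'⟩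

theorem partialProd_congr (h : ℕ → DegOne) {s t : ℕ → ZMod 2} {k : ℕ}
    (hst : ∀ j < k, s j = t j) : partialProd h s k = partialProd h t k := by
  induction k with
  | zero => rfl
  | succ k ih =>
    rw [partialProd, partialProd, ih fun j hj => hst j (hj.trans k.lt_succ_self),
      hst k k.lt_succ_self]

/-- A product of level `k` is also one of level `k + 1`, so the bounds imposed at step `k + 1` apply
to both. -/
theorem partialProd_update (h : ℕ → DegOne) (s : ℕ → ZMod 2) (k : ℕ) :
    partialProd h (Function.update s k 0) (k + 1) = partialProd h s k := by
  rw [partialProd, Function.update_self, if_pos rfl, mul_one]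
  exact partialProd_congr h fun j hj => Function.update_of_ne hj.ne _ _

/-- `β` is approximated by the rationals with denominators `q k`, with errors `O (1 / q (k + 1))`. -/
def IsApproximable (q : ℕ → ℕ) (β : ℝ) : Prop :=
  ∃ c : ℝ, 0 ≤ c ∧ ∀ k, ∃ m : ℤ, |β - m / q k| ≤ c / q (k + 1)

theorem IsApproximable.neg {q : ℕ → ℕ} {β : ℝ} (h : IsApproximable q β) :
    IsApproximable q (-β) := by
  obtain ⟨c, hc, H⟩ := h
  refine ⟨c, hc, fun k => ?_⟩
  obtain ⟨m, hm⟩ := H k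
  refine ⟨-m, ?_⟩
  rw [← abs_neg]
  convert hm using 2
  push_cast
  ring

theorem commute_translation_of_add {f : DegOne} {a : ℝ} (h : ∀ x, f (x + a) = f x + a) :
    Commute f (translation a) := DegOne.ext' h

theorem commute_translation_zsmul {f : DegOne} {a : ℝ} (h : Commute f (translation a)) (m : ℤ) :
    Commute f (translation (m * a)) := by
  have : translation (m * a) = translation a ^ m := by
    let φ : Multiplicative ℝ →* DegOne :=
      { toFun := fun x => translation x.toAdd
        map_one' := translation_zero
        map_mul' := fun x y => translation_add _ _ }
    have := map_zpow φ (Multiplicative.ofAdd a) m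
    rwa [← ofAdd_zsmul, zsmul_eq_mul] at this
  rw [this]
  exact h.zpow_right m

namespace IsTower

variable {q : ℕ → ℕ} {h : ℕ → DegOne} {ε : ℕ → ℝ}

theorem exists_step (T : IsTower q h ε) (k : ℕ) :
    ∃ Q e, IsStep k (Set.range fun s => partialProd h s k) Q e (q k) (h k) (ε k) := by
  cases k with
  | zero => exact ⟨_, _, T.zero⟩
  | succ k => exact ⟨_, _, T.succ k⟩

theorem q_pos (T : IsTower q h ε) (k : ℕ) : (0 : ℝ) < q k := by
  obtain ⟨_, _, H⟩ := T.exists_step k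
  exact_mod_cast H.pos

theorem growth (T : IsTower q h ε) (k : ℕ) : ((k : ℝ) + 3) * q k ≤ q (k + 1) := by
  have := (T.succ k).growth
  have h2 : (((k + 1 + 2) * q k : ℕ) : ℝ) ≤ q (k + 1) := by exact_mod_cast this
  push_cast at h2
  linarith

theorem two_mul_le (T : IsTower q h ε) (k : ℕ) : 2 * (q k : ℝ) ≤ q (k + 1) := by
  have h1 := T.growth k
  have h2 := T.q_pos k
  have : (0 : ℝ) ≤ k := by positivity
  nlinarith

theorem two_pow_le (T : IsTower q h ε) (k : ℕ) : (2 : ℝ) ^ k ≤ q k := by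
  induction k with
  | zero =>
    obtain ⟨_, _, H⟩ := T.exists_step 0
    rw [pow_zero]
    exact_mod_cast H.pos
  | succ k ih => rw [pow_succ]; linarith [T.two_mul_le k]

theorem smooth (T : IsTower q h ε) (k : ℕ) : h k ∈ smoothIso := by
  obtain ⟨_, _, H⟩ := T.exists_step k
  exact H.smooth

theorem smooth_factor (T : IsTower q h ε) (s : ℕ → ZMod 2) (k : ℕ) :
    (if s k = 0 then 1 else h k) ∈ smoothIso := by
  split_ifs
  · exact one_mem _
  · exact T.smooth k

theorem smooth_partialProd (T : IsTower q h ε) (s : ℕ → ZMod 2) (k : ℕ) :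
    partialProd h s k ∈ smoothIso := by
  induction k with
  | zero => exact one_mem _
  | succ k ih => exact mul_mem ih (T.smooth_factor s k)

theorem near (T : IsTower q h ε) (s : ℕ → ZMod 2) (k : ℕ) (x : ℝ) :
    |(if s k = 0 then 1 else h k : DegOne) x - x| ≤ 1 / q k := by
  have := T.q_pos k
  split_ifs
  · simp
  · obtain ⟨_, _, H⟩ := T.exists_step k
    exact H.near x

theorem commute (T : IsTower q h ε) (s : ℕ → ZMod 2) (k : ℕ) (m : ℤ) :
    Commute (if s k = 0 then 1 else h k : DegOne) (translation (m / q k)) := by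
  split_ifs
  · exact Commute.one_left _
  · obtain ⟨_, _, H⟩ := T.exists_step k
    have := commute_translation_zsmul (commute_translation_of_add H.commute) m
    rwa [mul_one_div] at this

/-- The products of the factors of high levels are close to the identity. -/
theorem inv_partialProd_near (T : IsTower q h ε) (s : ℕ → ZMod 2) (n k : ℕ) (x : ℝ) :
    |(partialProd h s k)⁻¹ (partialProd h s (k + n) x) - x| ≤ 2 / q k := by
  induction n generalizing k with
  | zero =>
    have := T.q_pos k
    simp only [add_zero, inv_apply, sub_self, abs_zero]
    positivity
  | succ n ih =>
    -- The factor of level `k` is peeled off on the left; it costs `1 / q k`, and the rest costs `2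
    -- / q (k + 1) ≤ 1 / q k`.
    have h1 := ih (k + 1)
    rw [show k + 1 + n = k + (n + 1) by ring] at h1
    set y := (partialProd h s (k + 1))⁻¹ (partialProd h s (k + (n + 1)) x) with hy
    have h2 : (partialProd h s k)⁻¹ (partialProd h s (k + (n + 1)) x) =
        (if s k = 0 then 1 else h k : DegOne) y := by
      have : (partialProd h s k)⁻¹ = (if s k = 0 then 1 else h k) *
          (partialProd h s (k + 1))⁻¹ := by
        rw [partialProd, mul_inv_rev, mul_inv_cancel_left]
      rw [this, DegOne.mul_apply]
    have h3 := T.near s k y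
    have h4 : 2 / (q (k + 1) : ℝ) ≤ 1 / q k := by
      rw [div_le_div_iff₀ (T.q_pos _) (T.q_pos _)]
      linarith [T.two_mul_le k]
    rw [h2]
    calc _ = |((if s k = 0 then 1 else h k : DegOne) y - y) + (y - x)| := by ring_nf
      _ ≤ 1 / q k + 2 / q (k + 1) := (abs_add_le _ _).trans (add_le_add h3 h1)
      _ ≤ 2 / q k := by
        rw [show (2 : ℝ) / q k = 1 / q k + 1 / q k by ring]
        linarith

theorem two_div_le (T : IsTower q h ε) (k : ℕ) : 2 / (q k : ℝ) ≤ 2 / 2 ^ k := by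
  have := T.two_pow_le k
  gcongr

theorem exists_limit (T : IsTower q h ε) (s : ℕ → ZMod 2) :
    ∃ g : DegOne, (∀ k x, |g x - partialProd h s k x| ≤ 2 / 2 ^ k) ∧
      ∀ k x, |g⁻¹ x - (partialProd h s k)⁻¹ x| ≤ 2 / 2 ^ k := by
  refine DegOne.exists_limit
    (tendsto_const_nhds.div_atTop (tendsto_pow_atTop_atTop_of_one_lt one_lt_two))
    (fun k n x => ?_) (fun k n x => ?_)
  · obtain ⟨_, _, H⟩ := T.exists_step k
    obtain ⟨L, hL1, hL, -, hLip⟩ := H.biLipschitz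
    -- The later factors act inside `partialProd h s k`, moving points by at most `2 / q k`; the
    -- Lipschitz constant `L` of the outer map is negligible against `q k`.
    have h1 := (hLip _ ⟨s, rfl⟩ ((partialProd h s k)⁻¹ (partialProd h s (k + n) x)) x).1
    rw [DegOne.apply_inv] at h1
    refine h1.trans ?_
    have h2 := T.inv_partialProd_near s n k x
    have h3 := T.q_pos k
    calc _ ≤ L * (2 / q k) := by gcongr
      _ ≤ 2 / 2 ^ k := by
        rw [← mul_div_assoc, div_le_div_iff₀ h3 (by positivity)]
        nlinarith [show 0 ≤ L * 2 ^ k by positivity]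
  · have h1 := T.inv_partialProd_near s n k ((partialProd h s (k + n))⁻¹ x)
    rw [DegOne.apply_inv, abs_sub_comm] at h1
    exact h1.trans (T.two_div_le k)

end IsTower

/-- `g` is the limit of the products of the factors of a tower selected by `s`. -/
def IsTowerLimit (h : ℕ → DegOne) (s : ℕ → ZMod 2) (g : DegOne) : Prop :=
  (∀ k x, |g x - partialProd h s k x| ≤ 2 / 2 ^ k) ∧
    ∀ k x, |g⁻¹ x - (partialProd h s k)⁻¹ x| ≤ 2 / 2 ^ k

theorem tendsto_two_div_two_pow : Tendsto (fun k : ℕ => (2 : ℝ) / 2 ^ k) atTop (𝓝 0) :=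
  tendsto_const_nhds.div_atTop (tendsto_pow_atTop_atTop_of_one_lt one_lt_two)

namespace IsTowerLimit

variable {q : ℕ → ℕ} {h : ℕ → DegOne} {ε : ℕ → ℝ} {s : ℕ → ZMod 2} {g : DegOne}

theorem tendsto (G : IsTowerLimit h s g) (x : ℝ) :
    Tendsto (fun k => partialProd h s k x) atTop (𝓝 (g x)) :=
  (DegOne.tendsto_of_close tendsto_two_div_two_pow G.1).tendsto_at x

theorem tendsto_conjTranslation (G : IsTowerLimit h s g) (β x : ℝ) :
    Tendsto (fun k => conjTranslation (partialProd h s k) β x) atTop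
      (𝓝 (conjTranslation g β x)) := by
  have h1 := DegOne.tendsto_of_close tendsto_two_div_two_pow G.1
  have h2 := (DegOne.tendsto_of_close (f := fun k => (partialProd h s k)⁻¹)
    tendsto_two_div_two_pow G.2).tendsto_at x
  exact h1.tendsto_comp g.continuous.continuousAt (h2.add_const β)

theorem inv_near (G : IsTowerLimit h s g) (T : IsTower q h ε) (k : ℕ) (x : ℝ) :
    |(partialProd h s k)⁻¹ (g x) - x| ≤ 2 / q k := by
  have h1 := ((partialProd h s k)⁻¹.continuous.tendsto _).comp
    ((G.tendsto x).comp (tendsto_add_atTop_nat k))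
  refine le_of_tendsto ((h1.sub_const x).abs) (Eventually.of_forall fun n => ?_)
  simp only [Function.comp]
  rw [add_comm n k]
  exact T.inv_partialProd_near s n k x

/-- Beyond level `k` both products acquire the same factors on the right, so their left quotient
stays fixed and passes to the limit. -/
theorem eq_mul_of_forall_ge (G : IsTowerLimit h s g) {t : ℕ → ZMod 2} {f : DegOne}
    (G' : IsTowerLimit h t f) {k : ℕ} (hst : ∀ j, k ≤ j → s j = t j) :
    g = partialProd h s k * (partialProd h t k)⁻¹ * f := by
  have key : ∀ n, partialProd h s (n + k) =
      partialProd h s k * (partialProd h t k)⁻¹ * partialProd h t (n + k) := by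
    intro n
    induction n with
    | zero => simp
    | succ n ih =>
      rw [Nat.succ_add, partialProd, ih, partialProd, hst (n + k) (by omega), ← mul_assoc]
  refine DegOne.ext' fun x => ?_
  refine tendsto_nhds_unique ((G.tendsto x).comp (tendsto_add_atTop_nat k)) ?_
  have h1 := ((partialProd h s k * (partialProd h t k)⁻¹).continuous.tendsto _).comp
    ((G'.tendsto x).comp (tendsto_add_atTop_nat k))
  refine h1.congr fun n => ?_
  simp only [Function.comp]
  rw [key n]
  rfl

end IsTowerLimit

/-- The conjugates of an approximable rotation by the partial products of a tower converge in the
`C^∞` topology, uniformly in `s`. -/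
theorem IsTower.exists_conj_bound {q : ℕ → ℕ} {h : ℕ → DegOne} {ε : ℕ → ℝ} (T : IsTower q h ε)
    {β : ℝ} (hβ : IsApproximable q β) : ∃ M : ℝ, ∀ s g, IsTowerLimit h s g →
      ContDiff ℝ ∞ (conjTranslation g β) ∧ ∀ r k, r ≤ k → ∀ x,
        |iteratedDeriv r (conjTranslation g β) x -
          iteratedDeriv r (conjTranslation (partialProd h s k) β) x| ≤ M / 2 ^ k := by
  obtain ⟨c, hc, H⟩ := hβ
  refine ⟨2 * c, fun s g G => smooth_limit
    (fun k => (conjTranslation_mem_smoothIso (T.smooth_partialProd s k) β).1)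
    (fun r k hrk x => ?_) (G.tendsto_conjTranslation β)⟩
  -- Levels `k` and `k + 1` are compared through the rational `m / q k`, at which both conjugates
  -- coincide because `h k` commutes with that translation (`e3`).
  obtain ⟨m, hm⟩ := H k
  have hC := (T.succ k).conjLipschitz
  have e1 := hC _ ⟨s, rfl⟩ r (by omega) β (m / q k) x
  have e2 := hC _ ⟨Function.update s k 0, rfl⟩ r (by omega) β (m / q k) x
  simp only [partialProd_update] at e2
  have e3 : conjTranslation (partialProd h s (k + 1)) (m / q k) =
      conjTranslation (partialProd h s k) (m / q k) := by
    have := (T.commute s k m).eq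
    rw [conjTranslation, conjTranslation, partialProd, mul_assoc (partialProd h s k), this]
    group
  rw [e3] at e1
  have hq := T.q_pos (k + 1)
  have e4 : (q (k + 1) / 4 ^ (k + 1) : ℝ) * |β - m / q k| ≤ c / 4 ^ (k + 1) := by
    calc _ ≤ (q (k + 1) / 4 ^ (k + 1) : ℝ) * (c / q (k + 1)) := by gcongr
      _ = _ := by field_simp
  have e5 : c / 4 ^ (k + 1) + c / 4 ^ (k + 1) ≤ 2 * c / 2 / 2 ^ k := by
    have h4 : (2 : ℝ) ^ k ≤ 4 ^ k := by gcongr; norm_num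
    calc c / 4 ^ (k + 1) + c / 4 ^ (k + 1) = c / (2 * 4 ^ k) := by
          rw [pow_succ]
          field_simp
          norm_num
          ring
      _ ≤ c / 2 ^ k := by
          gcongr
          linarith [show (0 : ℝ) < 4 ^ k by positivity]
      _ = _ := by ring
  refine le_trans ?_ e5
  calc _ ≤ _ := abs_sub_le _ (iteratedDeriv r (conjTranslation (partialProd h s k) (m / q k)) x) _
    _ ≤ _ := add_le_add (e1.trans e4) ((abs_sub_comm _ _).le.trans (e2.trans e4))


/-! ### Rotation numbers -/

namespace IsTower

variable {q : ℕ → ℕ} {h : ℕ → DegOne} {ε : ℕ → ℝ}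

theorem two_pow_mul_le (T : IsTower q h ε) (k j : ℕ) : 2 ^ j * (q k : ℝ) ≤ q (j + k) := by
  induction j with
  | zero => simp
  | succ j ih =>
    rw [pow_succ, Nat.succ_add]
    linarith [T.two_mul_le (j + k)]

theorem dvd_of_le (T : IsTower q h ε) {j k : ℕ} (hjk : j ≤ k) : q j ∣ q k := by
  induction k, hjk using Nat.le_induction with
  | base => rfl
  | succ k _ ih => exact ih.trans (T.succ k).dvd

theorem norm_term_le (T : IsTower q h ε) {c : ℕ → ℤ} {M : ℝ} (hc : ∀ j, |(c j : ℝ)| ≤ M) (k j : ℕ) :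
    ‖(c (j + k) : ℝ) / q (j + k)‖ ≤ M / q k * (1 / 2) ^ j := by
  have h1 := T.two_pow_mul_le k j
  have h2 := T.q_pos k
  have h3 : 0 ≤ M := (abs_nonneg _).trans (hc 0)
  rw [Real.norm_eq_abs, abs_div, abs_of_pos (T.q_pos (j + k))]
  calc |(c (j + k) : ℝ)| / q (j + k) ≤ M / (2 ^ j * q k) := by gcongr; exact hc _
    _ = _ := by
      rw [one_div, inv_pow]
      field_simp

theorem summable_tail (T : IsTower q h ε) {c : ℕ → ℤ} {M : ℝ} (hc : ∀ j, |(c j : ℝ)| ≤ M) (k : ℕ) :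
    Summable fun j => (c (j + k) : ℝ) / q (j + k) :=
  Summable.of_norm_bounded (summable_geometric_two.mul_left _) (T.norm_term_le hc k)

theorem summable (T : IsTower q h ε) {c : ℕ → ℤ} {M : ℝ} (hc : ∀ j, |(c j : ℝ)| ≤ M) :
    Summable fun j => (c j : ℝ) / q j :=
  T.summable_tail hc 0

theorem abs_tail_le (T : IsTower q h ε) {c : ℕ → ℤ} {M : ℝ} (hc : ∀ j, |(c j : ℝ)| ≤ M) (k : ℕ) :
    |∑' j, (c (j + k) : ℝ) / q (j + k)| ≤ 2 * M / q k := by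
  have := tsum_of_norm_bounded (hasSum_geometric_two.mul_left (M / q k)) (T.norm_term_le hc k)
  rw [Real.norm_eq_abs] at this
  exact this.trans (le_of_eq (by ring))

theorem exists_head_eq (T : IsTower q h ε) (c : ℕ → ℤ) (k : ℕ) :
    ∃ m : ℤ, ∑ j ∈ Finset.range (k + 1), (c j : ℝ) / q j = m / q k := by
  refine ⟨∑ j ∈ Finset.range (k + 1), c j * (q k / q j : ℕ), ?_⟩
  simp only [Int.cast_sum, Int.cast_mul, Int.cast_natCast]
  rw [Finset.sum_div]
  refine Finset.sum_congr rfl fun j hj => ?_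
  have h1 := T.q_pos j
  have h2 := T.q_pos k
  rw [Nat.cast_div (T.dvd_of_le (Nat.lt_succ_iff.1 (Finset.mem_range.1 hj))) h1.ne']
  field_simp

theorem isApproximable_tsum (T : IsTower q h ε) {c : ℕ → ℤ} {M : ℝ} (hc : ∀ j, |(c j : ℝ)| ≤ M) :
    IsApproximable q (∑' j, (c j : ℝ) / q j) := by
  have h3 : 0 ≤ M := (abs_nonneg _).trans (hc 0)
  refine ⟨2 * M, by positivity, fun k => ?_⟩
  obtain ⟨m, hm⟩ := T.exists_head_eq c k
  refine ⟨m, ?_⟩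
  rw [← (T.summable hc).sum_add_tsum_nat_add (k + 1), hm, add_sub_cancel_left]
  exact T.abs_tail_le hc (k + 1)

/-- If the sum is an integer, then almost all of its terms vanish. -/
theorem eventually_eq_zero_of_tsum_eq (T : IsTower q h ε) {c : ℕ → ℤ} {M : ℝ}
    (hc : ∀ j, |(c j : ℝ)| ≤ M) {p : ℤ} (hp : ∑' j, (c j : ℝ) / q j = p) :
    ∀ᶠ j in atTop, c j = 0 := by
  have h3 : 0 ≤ M := (abs_nonneg _).trans (hc 0)
  -- The tail is a multiple of `1 / q k`, yet at most `2 * M / q (k + 1)`, which is less than `1 / q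
  -- k` since `q (k + 1) ≥ (k + 3) * q k`.
  have tail : ∀ k : ℕ, 2 * M < k + 3 → ∑' j, (c (j + (k + 1)) : ℝ) / q (j + (k + 1)) = 0 := by
    intro k hk
    obtain ⟨m, hm⟩ := T.exists_head_eq c k
    have hsum := (T.summable hc).sum_add_tsum_nat_add (k + 1)
    rw [hm, hp] at hsum
    set τ := ∑' j, (c (j + (k + 1)) : ℝ) / q (j + (k + 1))
    have hq := T.q_pos k
    have hτ : τ = ((p * q k - m : ℤ) : ℝ) / q k := by
      push_cast
      field_simp
      rw [← hsum]
      field_simp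
      ring
    have hb : |τ| ≤ 2 * M / q (k + 1) := T.abs_tail_le hc (k + 1)
    rw [hτ, abs_div, abs_of_pos hq, div_le_div_iff₀ hq (T.q_pos _)] at hb
    have hlt : |((p * q k - m : ℤ) : ℝ)| < 1 := by
      by_contra hge
      push Not at hge
      have h4 := T.growth k
      have h5 : (q (k + 1) : ℝ) ≤ |((p * q k - m : ℤ) : ℝ)| * q (k + 1) :=
        le_mul_of_one_le_left (T.q_pos _).le hge
      nlinarith
    have h0 : p * q k - m = 0 := Int.abs_lt_one_iff.1 (by exact_mod_cast hlt)
    rw [hτ, h0]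
    simp
  obtain ⟨N, hN⟩ := exists_nat_gt (2 * M)
  filter_upwards [eventually_ge_atTop (N + 1)] with j hj
  obtain ⟨k, rfl⟩ := Nat.exists_eq_add_of_le' (show 1 ≤ j by omega)
  have hk : (N : ℝ) ≤ k := by exact_mod_cast Nat.le_of_succ_le_succ hj
  have t1 := tail k (by linarith)
  have t2 := tail (k + 1) (by push_cast; linarith)
  -- Two consecutive vanishing tails differ by a single term, which therefore vanishes.
  rw [(T.summable_tail hc (k + 1)).tsum_eq_zero_add] at t1
  have e : ∀ j : ℕ, j + 1 + (k + 1) = j + (k + 1 + 1) := fun j => by ring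
  simp only [e, t2, zero_add, add_zero] at t1
  have hq := T.q_pos (k + 1)
  rw [div_eq_zero_iff, or_iff_left hq.ne'] at t1
  exact_mod_cast t1

end IsTower

/-- The homomorphism from `ℤ^d` to the line whose values are the rotation numbers of the
constructed actions. -/
noncomputable def rotationNumber {d : ℕ} [NeZero d] (q : ℕ → ℕ) (n : Fin d → ℤ) : ℝ :=
  ∑' j, (n (Fin.ofNat d j) : ℝ) / q j

theorem exists_abs_le {d : ℕ} [NeZero d] (n : Fin d → ℤ) :
    ∃ M : ℝ, ∀ j, |(n (Fin.ofNat d j) : ℝ)| ≤ M := by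
  obtain ⟨M, hM⟩ := (Set.finite_range fun i => |(n i : ℝ)|).bddAbove
  exact ⟨M, fun j => hM ⟨_, rfl⟩⟩

namespace IsTower

variable {q : ℕ → ℕ} {h : ℕ → DegOne} {ε : ℕ → ℝ} {d : ℕ} [NeZero d]

theorem rotationNumber_add (T : IsTower q h ε) (m n : Fin d → ℤ) :
    rotationNumber q (m + n) = rotationNumber q m + rotationNumber q n := by
  obtain ⟨M, hM⟩ := exists_abs_le m
  obtain ⟨N, hN⟩ := exists_abs_le n
  rw [rotationNumber, rotationNumber, rotationNumber, ← (T.summable hM).tsum_add (T.summable hN)]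
  simp only [Pi.add_apply, Int.cast_add, add_div]

theorem isApproximable_rotationNumber (T : IsTower q h ε) (n : Fin d → ℤ) :
    IsApproximable q (rotationNumber q n) := by
  obtain ⟨M, hM⟩ := exists_abs_le n
  exact T.isApproximable_tsum hM

theorem eq_zero_of_rotationNumber_eq_int (T : IsTower q h ε) {n : Fin d → ℤ} {p : ℤ}
    (hp : rotationNumber q n = p) : n = 0 := by
  obtain ⟨M, hM⟩ := exists_abs_le n
  obtain ⟨N, hN⟩ := eventually_atTop.1 (T.eventually_eq_zero_of_tsum_eq hM hp)
  funext i
  have hd : 0 < d := Nat.pos_of_ne_zero (NeZero.ne d)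
  -- Each coordinate of `n` recurs periodically among the coefficients, in particular at an index
  -- beyond `N`.
  have := hN (i + d * N) ((Nat.le_mul_of_pos_left N hd).trans (Nat.le_add_left _ _))
  have hi : Fin.ofNat d (i + d * N) = i := Fin.ext (by
    rw [Fin.val_ofNat, Nat.add_mul_mod_self_left, Nat.mod_eq_of_lt i.2])
  rwa [hi] at this

/-- The rotation numbers as a homomorphism. -/
noncomputable def rotationHom (T : IsTower q h ε) : (Fin d → ℤ) →+ ℝ :=
  AddMonoidHom.mk' (rotationNumber q) T.rotationNumber_add

theorem irrational_rotationNumber (T : IsTower q h ε) {n : Fin d → ℤ} (hn : n ≠ 0) :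
    Irrational (rotationNumber q n) := by
  rintro ⟨x, hx⟩
  have h1 : rotationNumber q ((x.den : ℤ) • n) = x.num := by
    have := map_zsmul T.rotationHom (x.den : ℤ) n
    change rotationNumber q _ = _ • rotationNumber q n at this
    rw [this, ← hx, zsmul_eq_mul]
    have := Rat.den_mul_eq_num x
    exact_mod_cast this
  have h2 := T.eq_zero_of_rotationNumber_eq_int h1
  rcases smul_eq_zero.1 h2 with h3 | h3
  · exact x.den_nz (by exact_mod_cast h3)
  · exact hn h3

end IsTower

/-! ### The actions -/

theorem DegOne.add_int (f : DegOne) (x : ℝ) (m : ℤ) : f (x + m) = f x + m := by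
  have h1 : ∀ x, f (x + 1) = f x + 1 := f.add_one
  have := commute_translation_zsmul (commute_translation_of_add h1) m
  rw [mul_one] at this
  exact congrArg (fun g : DegOne => g x) this.eq

/-- If the conjugate of a translation has a fixed point on the circle, then the translation length
is an integer. -/
theorem exists_int_of_fixedPoint {g : DegOne} {β : ℝ} {x : S1}
    (hx : toCircle (conjTranslation g β) x = x) : ∃ p : ℤ, β = p := by
  obtain ⟨a, rfl⟩ := QuotientAddGroup.mk_surjective x
  change ((conjTranslation g β a : ℝ) : S1) = (a : S1) at hx
  rw [← sub_eq_zero, ← AddCircle.coe_sub, AddCircle.coe_eq_zero_iff] at hx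
  obtain ⟨m, hm⟩ := hx
  refine ⟨m, ?_⟩
  have h1 : g (g⁻¹ a + β) = g (g⁻¹ a + m) := by
    rw [DegOne.add_int, DegOne.apply_inv, ← conjTranslation_apply]
    simp only [zsmul_eq_mul, mul_one] at hm
    linarith
  exact add_left_cancel (g.strictMono.injective h1)

/-- Agreement on the first `N` coordinates defines a neighbourhood in the product of discrete
spaces. -/
theorem continuous_uniformFun_of_cylinder {α β : Type*} [PseudoMetricSpace β]
    {f : (ℕ → ZMod 2) → α → β}
    (h : ∀ e > 0, ∃ N, ∀ s t, (∀ k < N, t k = s k) → ∀ x, dist (f s x) (f t x) < e) :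
    Continuous fun s => UniformFun.ofFun (f s) := by
  refine continuous_iff_continuousAt.2 fun s => ?_
  refine UniformFun.tendsto_iff_tendstoUniformly.2 ?_
  rw [Metric.tendstoUniformly_iff]
  intro e he
  obtain ⟨N, hN⟩ := h e he
  have hev : ∀ᶠ t in 𝓝 s, ∀ k ∈ Set.Iio N, t k = s k := by
    refine (Filter.eventually_all_finite (Set.finite_Iio N)).2 fun k _ => ?_
    exact (continuous_apply k).continuousAt.eventually
      ((isOpen_discrete {s k}).mem_nhds rfl)
  filter_upwards [hev] with t ht x
  exact hN s t ht x

section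

variable {q : ℕ → ℕ} {h : ℕ → DegOne} {ε : ℕ → ℝ} {g : (ℕ → ZMod 2) → DegOne}

theorem mem_smoothIso_of_isTowerLimit (T : IsTower q h ε) {s : ℕ → ZMod 2} {f : DegOne}
    (G : IsTowerLimit h s f) {β : ℝ} (hβ : IsApproximable q β) :
    conjTranslation f β ∈ smoothIso := by
  obtain ⟨M, hM⟩ := T.exists_conj_bound hβ
  obtain ⟨M', hM'⟩ := T.exists_conj_bound hβ.neg
  refine ⟨(hM s f G).1, ?_⟩
  rw [← conjTranslation_neg]
  exact (hM' s f G).1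

/-- Sequences that agree below `N` share the partial product of level `N`, and both limits are
within `M / 2 ^ N` of its conjugate, with `M` independent of the sequence. -/
theorem exists_cylinder_iteratedDeriv_close (T : IsTower q h ε) (G : ∀ s, IsTowerLimit h s (g s))
    {β : ℝ} (hβ : IsApproximable q β) (r : ℕ) {e : ℝ} (he : 0 < e) :
    ∃ N, ∀ s t, (∀ k < N, t k = s k) → ∀ x,
      |iteratedDeriv r (conjTranslation (g s) β) x -
        iteratedDeriv r (conjTranslation (g t) β) x| < e := by
  obtain ⟨M, hM⟩ := T.exists_conj_bound hβ
  have h0 : Tendsto (fun k : ℕ => M / 2 ^ k) atTop (𝓝 0) :=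
    tendsto_const_nhds.div_atTop (tendsto_pow_atTop_atTop_of_one_lt one_lt_two)
  obtain ⟨N, hN, hr⟩ := ((h0.eventually_lt_const (half_pos he)).and
    (eventually_ge_atTop r)).exists
  refine ⟨N, fun s t hst x => ?_⟩
  have h1 := (hM s _ (G s)).2 r N hr x
  have h2 := (hM t _ (G t)).2 r N hr x
  rw [partialProd_congr h hst, abs_sub_comm] at h2
  exact ((abs_sub_le _ _ _).trans (add_le_add h1 h2)).trans_lt (by linarith)

theorem continuous_jets (T : IsTower q h ε) (G : ∀ s, IsTowerLimit h s (g s)) {β : ℝ}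
    (hβ : IsApproximable q β) :
    Continuous fun s => jets (toCircle (conjTranslation (g s) β)) := by
  refine Continuous.prodMk ?_ (continuous_pi fun i => ?_)
  · refine continuous_uniformFun_of_cylinder fun e he => ?_
    obtain ⟨N, hN⟩ := exists_cylinder_iteratedDeriv_close T G hβ 0 he
    refine ⟨N, fun s t hst x => ?_⟩
    obtain ⟨a, rfl⟩ := QuotientAddGroup.mk_surjective x
    exact (dist_coe_le _ _).trans_lt (by simpa using hN s t hst a)
  · simp only [iteratedDeriv_lift]
    refine continuous_uniformFun_of_cylinder fun e he => ?_
    exact exists_cylinder_iteratedDeriv_close T G hβ (i + 1) he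

/-- The free action of `ℤ^d` that is conjugate by `f` to the rotations by the rotation numbers. -/
noncomputable def towerAction {d : ℕ} [NeZero d] (T : IsTower q h ε) {s : ℕ → ZMod 2} {f : DegOne}
    (G : IsTowerLimit h s f) : FreeAction d :=
  ⟨{ toFun := fun n => toCircle (conjTranslation f (rotationNumber q n.toAdd))
     map_one' := by
       have : rotationNumber q (0 : Fin d → ℤ) = 0 := map_zero T.rotationHom
       rw [toAdd_one, this, conjTranslation_zero, map_one]
     map_mul' := fun m n => by
       rw [toAdd_mul, T.rotationNumber_add, conjTranslation_add, map_mul] },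
    fun n => toCircle_mem_diffeos
      (mem_smoothIso_of_isTowerLimit T G (T.isApproximable_rotationNumber _)),
    fun n x hx => by
      obtain ⟨p, hp⟩ := exists_int_of_fixedPoint hx
      exact T.eq_zero_of_rotationNumber_eq_int hp⟩

theorem towerAction_apply {d : ℕ} [NeZero d] (T : IsTower q h ε) {s : ℕ → ZMod 2} {f : DegOne}
    (G : IsTowerLimit h s f) (n : Multiplicative (Fin d → ℤ)) :
    (towerAction T G).1 n = toCircle (conjTranslation f (rotationNumber q n.toAdd)) := rfl

theorem continuous_towerAction {d : ℕ} [NeZero d] (T : IsTower q h ε)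
    (G : ∀ s, IsTowerLimit h s (g s)) :
    Continuous fun s => (towerAction T (G s) : FreeAction d) := by
  refine continuous_induced_rng.2 (continuous_pi fun i => continuous_induced_rng.2 ?_)
  refine Continuous.prodMk (continuous_jets T G (T.isApproximable_rotationNumber _)) ?_
  -- The inverse is the conjugate of the opposite translation, so the jets of the inverses need no
  -- separate argument.
  have : ∀ β s, (toCircle (conjTranslation (g s) β)).symm =
      toCircle (conjTranslation (g s) (-β)) := fun β s => by
    rw [toCircle_symm, conjTranslation_neg]
  simp only [Function.comp, FreeAction.generators, towerAction_apply, this]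
  exact continuous_jets T G (T.isApproximable_rotationNumber _).neg

end

/-! ### Conjugacy -/

section

variable {q : ℕ → ℕ} {h : ℕ → DegOne} {ε : ℕ → ℝ} {s t : ℕ → ZMod 2} {f g : DegOne} {d : ℕ}
  [NeZero d] {D : Set (S1 ≃ₜ S1)}

theorem conjugate_of_eventually_eq (T : IsTower q h ε) (F : IsTowerLimit h s f)
    (G : IsTowerLimit h t g) (hD : diffeos ⊤ ⊆ D) (hst : ∀ᶠ k in atTop, s k = t k) :
    Conjugate D (towerAction T F : FreeAction d) (towerAction T G) := by
  obtain ⟨k, hk⟩ := eventually_atTop.1 hst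
  set w := partialProd h s k * (partialProd h t k)⁻¹
  have hw : w ∈ smoothIso := mul_mem (T.smooth_partialProd s k) (inv_mem (T.smooth_partialProd t k))
  have hf : f = w * g := F.eq_mul_of_forall_ge G hk
  refine ⟨toCircle w, hD (toCircle_mem_diffeos hw), fun n x => ?_⟩
  rw [towerAction_apply, towerAction_apply, toCircle_symm, hf]
  have : conjTranslation (w * g) (rotationNumber q n.toAdd) =
      w * conjTranslation g (rotationNumber q n.toAdd) * w⁻¹ := by
    simp only [conjTranslation]
    group
  rw [this, map_mul, map_mul]
  rfl

/-- A circle map that commutes with an irrational rotation is a rotation. -/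
theorem eq_add_of_commute_irrational {u : S1 → S1} (hu : Continuous u) {a : ℝ} (ha : Irrational a)
    (h : ∀ x, u (x + a) = u x + a) (x : S1) : u x = u 0 + x := by
  have hdense : DenseRange fun n : ℤ => n • (a : S1) :=
    AddCircle.denseRange_zsmul_coe_iff.2 (by simpa using ha)
  have hn : ∀ n : ℤ, u (n • (a : S1)) = u 0 + n • (a : S1) := by
    intro n
    induction n with
    | zero => simp
    | succ n ih => rw [add_zsmul, one_zsmul, h, ih, add_assoc]
    | pred n ih =>
      have := h ((-(n : ℤ) - 1) • (a : S1))
      rw [sub_zsmul, one_zsmul, neg_add_cancel_right, ih] at this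
      rw [sub_zsmul, one_zsmul, ← add_assoc]
      exact eq_add_neg_of_add_eq this.symm
  exact congrFun (hdense.equalizer hu (continuous_const.add continuous_id) (funext hn)) x

/-- Conjugacies between the constructed actions are induced by translations. -/
theorem exists_translation_of_conj (T : IsTower q h ε) (F : IsTowerLimit h s f)
    (G : IsTowerLimit h t g) {k : S1 ≃ₜ S1} (hk : ∀ n x, (towerAction T F : FreeAction d).1 n x =
      k ((towerAction T G : FreeAction d).1 n (k.symm x))) :
    ∃ θ : ℝ, ∀ x : ℝ, k ((g x : ℝ) : S1) = ((f (x + θ) : ℝ) : S1) := by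
  set n : Fin d → ℤ := Pi.single 0 1
  have hn : n ≠ 0 := fun h0 => by
    have := congrFun h0 0
    simp [n] at this
  set a := rotationNumber q n
  have ha : Irrational a := T.irrational_rotationNumber hn
  have hrot : ∀ x : S1, toCircle (translation a) x = x + a := fun x => by
    obtain ⟨b, rfl⟩ := QuotientAddGroup.mk_surjective x
    rfl
  -- One generator suffices: its conjugation equation says that `f⁻¹ ∘ k ∘ g` commutes with an
  -- irrational rotation.
  have hc : ∀ x, (toCircle f)⁻¹ (k (toCircle g (x + a))) =
      (toCircle f)⁻¹ (k (toCircle g x)) + a := by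
    intro x
    have h1 := hk (Multiplicative.ofAdd n) (k (toCircle g x))
    rw [k.symm_apply_apply, towerAction_apply, towerAction_apply, toAdd_ofAdd, conjTranslation,
      conjTranslation, map_mul, map_mul, map_mul, map_mul, map_inv, map_inv] at h1
    change toCircle f (toCircle (translation a) ((toCircle f)⁻¹ (k (toCircle g x)))) =
      k (toCircle g (toCircle (translation a) ((toCircle g)⁻¹ (toCircle g x)))) at h1
    have h2 : (toCircle g)⁻¹ (toCircle g x) = x := (toCircle g).symm_apply_apply x
    rw [h2, hrot, hrot] at h1
    rw [← h1]
    exact (toCircle f).symm_apply_apply _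
  have hu := eq_add_of_commute_irrational (u := fun x => (toCircle f)⁻¹ (k (toCircle g x)))
    ((toCircle f)⁻¹.continuous.comp (k.continuous.comp (toCircle g).continuous)) ha hc
  obtain ⟨θ, hθ⟩ := QuotientAddGroup.mk_surjective ((toCircle f)⁻¹ (k (toCircle g 0)))
  refine ⟨θ, fun x => ?_⟩
  have h3 := congrArg (toCircle f) (hu (x : S1))
  rw [← hθ] at h3
  have h4 : toCircle f ((toCircle f)⁻¹ (k (toCircle g (x : S1)))) = k (toCircle g (x : S1)) :=
    (toCircle f).apply_symm_apply _
  have h5 : k (toCircle g (x : S1)) = toCircle f ((θ : S1) + (x : S1)) := h4.symm.trans h3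
  rw [← AddCircle.coe_add, add_comm] at h5
  exact h5

/-- Take `η = 1 / (2 * q k * L)`. Up to errors `2 / q (k + 1)`, the points `x + θ` and `y + θ` are
`± ε k`. The map `f` contains `h k`, which spreads them to distance `1 / (2 * q k)`, and the earlier
factors lose at most `L`. The map `g` lacks `h k`, so it keeps them within `3 * L * ε k ≤ η ^ k`;
`θ` is harmless because the Lipschitz bounds are global. The upper bound `1 / 2` makes distances on
the line and on the circle agree. -/
theorem exists_dilated_pair (T : IsTower q h ε) (F : IsTowerLimit h s f)
    (G : IsTowerLimit h t g) (θ : ℝ) {k : ℕ} (hk : 1 ≤ k) (hs : s k ≠ 0) (ht : t k = 0) :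
    ∃ η : ℝ, 0 < η ∧ η ≤ 1 / 2 ^ k ∧ ∃ x y : ℝ, η ≤ |f (x + θ) - f (y + θ)| ∧
      |f (x + θ) - f (y + θ)| ≤ 1 / 2 ∧ |g x - g y| ≤ η ^ k := by
  obtain ⟨Q, e, H⟩ := T.exists_step k
  obtain ⟨L, hL1, hL, hLε, hLip⟩ := H.biLipschitz
  have hq := T.q_pos k
  have hq' := T.q_pos (k + 1)
  have hε := H.eps_pos
  have hpow := T.two_pow_le k
  have h2k : (1 : ℝ) ≤ 2 ^ k := one_le_pow₀ one_le_two
  set P := partialProd h s k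
  have hS : partialProd h s (k + 1) = P * h k := by rw [partialProd, if_neg hs]
  have hS' : partialProd h t (k + 1) = partialProd h t k := by
    rw [partialProd, if_pos ht, mul_one]
  have point : ∀ y : ℝ, ∃ x, f (x + θ) = P (h k y) ∧ |x + θ - y| ≤ 2 / q (k + 1) := by
    intro y
    refine ⟨f⁻¹ (P (h k y)) - θ, by rw [sub_add_cancel, DegOne.apply_inv], ?_⟩
    have := F.inv_near T (k + 1) (f⁻¹ (P (h k y)))
    have e1 : (P * h k)⁻¹ (P (h k y)) = y := DegOne.inv_apply (P * h k) y
    rw [DegOne.apply_inv, hS, e1, abs_sub_comm] at this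
    rwa [sub_add_cancel]
  obtain ⟨x, hx, hx'⟩ := point (ε k)
  obtain ⟨y, hy, hy'⟩ := point (-ε k)
  have hη : 1 / (2 * q k * L) ≤ 1 / (2 : ℝ) ^ k := by
    refine one_div_le_one_div_of_le (by positivity) ?_
    nlinarith [mul_le_mul_of_nonneg_left hL1 hq.le]
  refine ⟨1 / (2 * q k * L), by positivity, hη, x, y, ?_, ?_, ?_⟩
  · rw [hx, hy]
    have h1 := (hLip _ ⟨s, rfl⟩ (P (h k (ε k))) (P (h k (-ε k)))).2
    change |P⁻¹ (P (h k (ε k))) - P⁻¹ (P (h k (-ε k)))| ≤ _ at h1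
    rw [DegOne.inv_apply, DegOne.inv_apply] at h1
    have h2 := H.dilation.trans ((le_abs_self _).trans h1)
    rw [← div_div, div_le_iff₀ (by positivity)]
    linarith
  · rw [hx, hy]
    have h1 := (hLip _ ⟨s, rfl⟩ (h k (ε k)) (h k (-ε k))).1
    refine h1.trans ?_
    have h2 : |h k (ε k) - h k (-ε k)| ≤ 2 / q k + 2 * ε k := by
      have a1 := abs_le.1 (H.near (ε k))
      have a2 := abs_le.1 (H.near (-ε k))
      rw [show 2 / (q k : ℝ) = 1 / q k + 1 / q k by ring, abs_le]
      constructor <;> linarith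
    have h3 : L * (2 / q k) ≤ 1 / 8 := by
      rw [← mul_div_assoc, div_le_div_iff₀ hq (by norm_num)]
      nlinarith
    have h4 : 3 * L * ε k ≤ 1 / 2 := by
      refine hLε.trans ((pow_le_of_le_one (by positivity) ?_ (by omega)).trans ?_)
      · exact hη.trans (by rw [div_le_one (by positivity)]; exact h2k)
      · refine hη.trans (one_div_le_one_div_of_le two_pos ?_)
        simpa using pow_le_pow_right₀ (one_le_two : (1 : ℝ) ≤ 2) hk
    calc L * |h k (ε k) - h k (-ε k)| ≤ L * (2 / q k + 2 * ε k) := by gcongr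
      _ ≤ 1 / 2 := by linarith
  · refine le_trans ?_ hLε
    have b1 := abs_le.1 (G.inv_near T (k + 1) x)
    have b2 := abs_le.1 (G.inv_near T (k + 1) y)
    rw [hS'] at b1 b2
    have h1 := (hLip _ ⟨t, rfl⟩ ((partialProd h t k)⁻¹ (g x)) ((partialProd h t k)⁻¹ (g y))).1
    change |partialProd h t k _ - partialProd h t k _| ≤ _ at h1
    rw [DegOne.apply_inv, DegOne.apply_inv] at h1
    refine h1.trans ?_
    have h2 : 8 / (q (k + 1) : ℝ) ≤ ε k / 2 := by
      have := (T.succ k).div_le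
      rw [div_le_iff₀ hε] at this
      rw [div_le_div_iff₀ hq' two_pos]
      linarith
    -- The points lie `2 * ε k` apart up to four errors `2 / q (k + 1)`, whose sum is at most `ε k /
    -- 2`.
    have h3 : |(partialProd h t k)⁻¹ (g x) - (partialProd h t k)⁻¹ (g y)| ≤ 3 * ε k := by
      have a1 := abs_le.1 hx'
      have a2 := abs_le.1 hy'
      have e8 : 8 / (q (k + 1) : ℝ) = 4 * (2 / q (k + 1)) := by ring
      rw [abs_le]
      constructor <;> linarith
    calc _ ≤ L * (3 * ε k) := by gcongr
      _ = _ := by ring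

theorem not_conjugate_of_frequently (T : IsTower q h ε) (F : IsTowerLimit h s f)
    (G : IsTowerLimit h t g) (hD : D ⊆ holderHomeos) (hst : ∃ᶠ k in atTop, s k ≠ 0 ∧ t k = 0) :
    ¬ Conjugate D (towerAction T F : FreeAction d) (towerAction T G) := by
  rintro ⟨k, hkD, hk⟩
  obtain ⟨-, C, r, hr, hC⟩ := hD hkD
  obtain ⟨θ, hθ⟩ := exists_translation_of_conj T F G hk
  have hr' : (0 : ℝ) < r := by exact_mod_cast hr
  -- For `j ≥ N` one has `j * r ≥ 2`, so the Hölder bound gives `η ≤ C * η ^ 2`, which is absurd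
  -- once `C / 2 ^ j < 1`.
  obtain ⟨N, hN⟩ := exists_nat_gt (2 / (r : ℝ))
  have hlim : Tendsto (fun k : ℕ => (C : ℝ) * (1 / 2) ^ k) atTop (𝓝 0) := by
    simpa using (tendsto_pow_atTop_nhds_zero_of_lt_one (r := (1 / 2 : ℝ)) (by norm_num)
      (by norm_num)).const_mul (C : ℝ)
  obtain ⟨j, ⟨hs, ht⟩, hj1, hjN, hjC⟩ := (hst.and_eventually ((eventually_ge_atTop 1).and
    ((eventually_ge_atTop N).and (hlim.eventually_lt_const one_pos)))).exists
  obtain ⟨η, hη0, hη, x, y, h1, h2, h3⟩ := exists_dilated_pair T F G θ hj1 hs ht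
  have h4 := hC.dist_le (g x : S1) (g y : S1)
  rw [hθ, hθ, dist_coe_eq h2] at h4
  have hη1 : η ≤ 1 := hη.trans (by
    rw [div_le_one (by positivity)]
    exact one_le_pow₀ one_le_two)
  have h5 : dist (g x : S1) (g y : S1) ^ (r : ℝ) ≤ η ^ 2 := by
    calc _ ≤ (η ^ j) ^ (r : ℝ) :=
          Real.rpow_le_rpow dist_nonneg ((dist_coe_le _ _).trans h3) hr'.le
      _ = η ^ (j * (r : ℝ)) := by rw [← Real.rpow_natCast, ← Real.rpow_mul hη0.le]
      _ ≤ η ^ (2 : ℝ) := by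
          refine Real.rpow_le_rpow_of_exponent_ge hη0 hη1 ?_
          rw [div_lt_iff₀ hr'] at hN
          have : (N : ℝ) ≤ j := by exact_mod_cast hjN
          nlinarith
      _ = η ^ 2 := by norm_cast
  have h6 : η ≤ C * η ^ 2 := h1.trans (h4.trans (by gcongr))
  have h7 : 1 ≤ C * η := by
    by_contra hlt
    push Not at hlt
    nlinarith
  have h8 : (C : ℝ) * η ≤ C * (1 / 2) ^ j := by
    rw [one_div_pow]
    gcongr
  linarith

end


/-! ### Eventual equality on the Cantor group -/

theorem dense_eventually_zero : Dense {g : ℕ → ZMod 2 | ∀ᶠ k in atTop, g k = 0} := by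
  intro g
  refine mem_closure_of_tendsto (f := fun n k => if k < n then g k else 0) (b := atTop) ?_
    (Eventually.of_forall fun n => ?_)
  · rw [tendsto_pi_nhds]
    intro k
    refine tendsto_const_nhds.congr' ?_
    filter_upwards [eventually_gt_atTop k] with n hn
    rw [if_pos hn]
  · filter_upwards [eventually_ge_atTop n] with k hk
    rw [if_neg hk.not_gt]

open MeasureTheory in
/-- There is no complete numerical Borel invariant of eventual equality of binary sequences. -/
theorem not_exists_eventuallyEq_invariant (ψ : (ℕ → ZMod 2) → ℝ)
    (hm : @Measurable _ _ (borel (ℕ → ZMod 2)) (borel ℝ) ψ)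
    (hψ : ∀ s t, (∀ᶠ k in atTop, s k = t k) ↔ ψ s = ψ t) : False := by
  borelize (ℕ → ZMod 2)
  have hm' : Measurable ψ := by
    convert hm
  obtain ⟨μ, hμ⟩ : ∃ μ : Measure (ℕ → ZMod 2), μ.IsAddHaarMeasure :=
    ⟨Measure.addHaar, inferInstance⟩
  -- A zero-one law: `ψ` is invariant under translation by the dense set of eventually zero
  -- sequences, which acts ergodically for Haar measure.
  have hconst : ∀ U : Set ℝ, MeasurableSet U →
      (∀ᶠ x in ae μ, ψ x ∈ U) ∨ ∀ᶠ x in ae μ, ψ x ∉ U := by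
    intro U hU
    have h : EventuallyConst (ψ ⁻¹' U) (ae μ) :=
      aeconst_of_dense_setOfPred_preimage_vadd_eq (M := ℕ → ZMod 2) (hm' hU).nullMeasurableSet
        (dense_eventually_zero.mono fun g hg => by
          ext x
          have : ψ (g + x) = ψ x := (hψ _ _).1 (by
            filter_upwards [hg] with k hk
            rw [Pi.add_apply, hk, zero_add])
          change ψ (g + x) ∈ U ↔ ψ x ∈ U
          rw [this])
    exact eventuallyConst_set.1 h
  obtain ⟨c, hc⟩ := exists_eventuallyEq_const_of_forall_separating (l := ae μ) (f := ψ)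
    MeasurableSet hconst
  -- Translation by the constant sequence `1` preserves the measure but changes every coordinate, so
  -- `x` and `1 + x` have equal invariants without being eventually equal.
  have hc' : ∀ᵐ x ∂μ, ψ (1 + x) = c :=
    (measurePreserving_add_left μ 1).quasiMeasurePreserving.ae hc
  obtain ⟨x, h1, h2⟩ := (hc.and hc').exists
  have h3 := (hψ (1 + x) x).2 (h2.trans h1.symm)
  obtain ⟨k, hk⟩ := h3.exists
  simp at hk

end CircleActions

open CircleActions Filter in
theorem mainTheorem5 (d : ℕ) (hd : 2 ≤ d)
    (D : Set (CircleActions.S1 ≃ₜ CircleActions.S1))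
    (hD : CircleActions.IsRegularityClass D) :
    ¬ ∃ φ : CircleActions.FreeAction d → ℝ,
      CircleActions.IsCompleteNumericalBorelInvariant
        (CircleActions.Conjugate (d := d) D) φ := by
  rintro ⟨φ, hφm, hφ⟩
  have : NeZero d := ⟨by omega⟩
  obtain ⟨q, h, ε, T⟩ := exists_isTower
  choose g G using T.exists_limit
  let ρ : (ℕ → ZMod 2) → FreeAction d := fun s => towerAction T (G s)
  refine not_exists_eventuallyEq_invariant (φ ∘ ρ)
    (hφm.comp (continuous_towerAction T G).borel_measurable) fun s t =>
      ⟨fun hst => (hφ _ _).1 (conjugate_of_eventually_eq T (G s) (G t) hD.1 hst), fun hst => ?_⟩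
  by_contra hne
  -- Of two distinct elements of `ZMod 2` exactly one is zero, so one of the two patterns recurs
  -- infinitely often.
  have hfreq : ∃ᶠ k in atTop, (s k ≠ 0 ∧ t k = 0) ∨ (t k ≠ 0 ∧ s k = 0) := by
    refine (not_eventually.1 hne).mono fun k hk => ?_
    revert hk
    generalize s k = a
    generalize t k = b
    revert a b
    decide
  rcases frequently_or_distrib.1 hfreq with h1 | h1
  · exact not_conjugate_of_frequently T (G s) (G t) hD.2 h1 ((hφ _ _).2 hst)
  -- `D` need not be closed under inverses; the conjugacy in the other direction comes from the
  -- symmetry of equality of invariants.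
  · exact not_conjugate_of_frequently T (G t) (G s) hD.2 h1 ((hφ _ _).2 hst.symm)
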